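/- Let $0<\epsilon<1$ be given. Then there is an algorithm that takes as input an integer $n\ge 2$ and constructs, in time polynomial in $\log n$, an undirected simple $d$-regular circulant graph $G_n$ on $n$ vertices, where $$1\le d\le O(\log n),\qquad \lambda(G_n)\le\max\left\{\epsilon,\frac{1}{n-1}\right\}d .$$ The polynomial and the constant in $O(\cdot)$ depend only on $\epsilon$, and both bounds hold for every $n\ge 2$. Here $\lambda(G)=\max\{|\lambda_2|,\dots,|\lambda_n|\}$, where $\lambda_1\ge\lambda_2\ge\dots\ge\lambda_n$ are the eigenvalues, with multiplicity, of the adjacency matrix of $G$. A graph on $\{0,1,\dots,n-1\}$ is circulant if its adjacency matrix is the circulant matrix whose first row is the characteristic vector of some set $S\subseteq\{0,1,\dots,n-1\}$ and each of whose other rows is the previous row shifted cyclically by one entry to the right. An algorithm constructs this graph in time $T(n)$ if, on input $n$, it outputs the elements of $S$ in time $T(n)$. Time is measured on a random access machine under the logarithmic cost criterion (equivalently, up to a polynomial, on a multitape Turing machine). -/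

import Mathlib

/-!
## A random access machine with logarithmic cost

The memory consists of registers `R_0, R_1, R_2, …`, each holding a natural number. Programs are
structured (sequencing, branching, loops) and use direct and indirect addressing. Every instruction
is charged the total bit length of all numbers it handles: constants, register addresses, register
contents and results (the logarithmic cost criterion). The time used in this model and the time
used by a multitape Turing machine are polynomially related.
-/

namespace RAM

/-- The bit length of a natural number, with `bitLen 0 = 1`. -/
def bitLen (x : ℕ) : ℕ := Nat.log 2 x + 1

/-- The contents of the memory together with the list of the numbers output so far. -/
structure State where
  mem : ℕ → ℕ
  out : List ℕ

/-- A source operand: the constant `c`, the register `R_i`, or the register whose address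
is stored in `R_i`. -/
inductive Operand where
  | const (c : ℕ)
  | reg (i : ℕ)
  | ind (i : ℕ)

/-- The value of an operand. -/
def Operand.val (m : ℕ → ℕ) : Operand → ℕ
  | .const c => c
  | .reg i => m i
  | .ind i => m (m i)

/-- The cost of fetching an operand. -/
def Operand.cost (m : ℕ → ℕ) : Operand → ℕ
  | .const c => bitLen c
  | .reg i => bitLen i + bitLen (m i)
  | .ind i => bitLen i + bitLen (m i) + bitLen (m (m i))

/-- The destination of an assignment: the register `R_i`, or the register whose address
is stored in `R_i`. -/
inductive Dest where
  | reg (i : ℕ)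
  | ind (i : ℕ)

/-- The address of the register that a destination denotes. -/
def Dest.addr (m : ℕ → ℕ) : Dest → ℕ
  | .reg i => i
  | .ind i => m i

/-- The cost of determining the address of a destination. -/
def Dest.cost (m : ℕ → ℕ) : Dest → ℕ
  | .reg i => bitLen i
  | .ind i => bitLen i + bitLen (m i)

/-- The arithmetic operations. -/
inductive BinOp where
  | add
  | sub
  | mul
  | div
  | mod

/-- The results of the operations: subtraction is truncated at `0`, and `div`, `mod` are
quotient and remainder of the division of natural numbers. -/
def BinOp.eval : BinOp → ℕ → ℕ → ℕ
  | .add, a, b => a + b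
  | .sub, a, b => a - b
  | .mul, a, b => a * b
  | .div, a, b => a / b
  | .mod, a, b => a % b

/-- Programs. `assign r o x y` stores the result of the operation `o` on `x` and `y` in `r`;
`write x` appends the value of `x` to the output; `branch x y p q` runs `p` if `x < y` and `q`
otherwise; `loop x y p` runs `p` again and again as long as `x < y`. -/
inductive Prog where
  | skip
  | assign (r : Dest) (o : BinOp) (x y : Operand)
  | write (x : Operand)
  | seq (p q : Prog)
  | branch (x y : Operand) (p q : Prog)
  | loop (x y : Operand) (p : Prog)

/-- `Exec p s t s'`: the program `p`, started in the state `s`, halts in the state `s'` after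
time `t`. -/
inductive Exec : Prog → State → ℕ → State → Prop where
  | skip (s : State) : Exec .skip s 1 s
  | assign (r : Dest) (o : BinOp) (x y : Operand) (s : State) :
      Exec (.assign r o x y) s
        (x.cost s.mem + y.cost s.mem + r.cost s.mem
          + bitLen (o.eval (x.val s.mem) (y.val s.mem)))
        ⟨Function.update s.mem (r.addr s.mem) (o.eval (x.val s.mem) (y.val s.mem)), s.out⟩
  | write (x : Operand) (s : State) :
      Exec (.write x) s (x.cost s.mem) ⟨s.mem, s.out ++ [x.val s.mem]⟩
  | seq {p q : Prog} {s s₁ s₂ : State} {t₁ t₂ : ℕ}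
      (hp : Exec p s t₁ s₁) (hq : Exec q s₁ t₂ s₂) : Exec (.seq p q) s (t₁ + t₂) s₂
  | branch_true {x y : Operand} {p q : Prog} {s s₁ : State} {t : ℕ}
      (h : x.val s.mem < y.val s.mem) (hp : Exec p s t s₁) :
      Exec (.branch x y p q) s (x.cost s.mem + y.cost s.mem + t) s₁
  | branch_false {x y : Operand} {p q : Prog} {s s₁ : State} {t : ℕ}
      (h : ¬ x.val s.mem < y.val s.mem) (hq : Exec q s t s₁) :
      Exec (.branch x y p q) s (x.cost s.mem + y.cost s.mem + t) s₁
  | loop_true {x y : Operand} {p : Prog} {s s₁ s₂ : State} {t₁ t₂ : ℕ}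
      (h : x.val s.mem < y.val s.mem) (hp : Exec p s t₁ s₁)
      (hl : Exec (.loop x y p) s₁ t₂ s₂) :
      Exec (.loop x y p) s (x.cost s.mem + y.cost s.mem + t₁ + t₂) s₂
  | loop_false {x y : Operand} {p : Prog} {s : State}
      (h : ¬ x.val s.mem < y.val s.mem) :
      Exec (.loop x y p) s (x.cost s.mem + y.cost s.mem) s

/-- The initial state on input `n`: the register `R_0` holds `n`, all other registers hold `0`,
and nothing has been output. -/
def init (n : ℕ) : State := ⟨fun i => if i = 0 then n else 0, []⟩

/-- On input `n`, the program `p` halts after time `t`, having output the list `L`. -/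
def Outputs (p : Prog) (n t : ℕ) (L : List ℕ) : Prop :=
  ∃ s : State, Exec p (init n) t s ∧ s.out = L

end RAM

namespace CirculantExpander

/-- The circulant matrix whose row `0` is the characteristic vector of `S`; its entry at `(i, j)`
is `1` if `(j - i) mod n ∈ S` and `0` otherwise. -/
def circ {n : ℕ} (S : Finset (Fin n)) : Matrix (Fin n) (Fin n) ℝ :=
  (Matrix.circulant fun k : Fin n => if k ∈ S then (1 : ℝ) else 0).transpose

/-- `L` lists the elements of `S`, as numbers in `{0, …, n - 1}`, in some order and each one
exactly once. -/
def Enumerates {n : ℕ} (L : List ℕ) (S : Finset (Fin n)) : Prop :=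
  L.Nodup ∧ ∀ a : ℕ, a ∈ L ↔ ∃ s ∈ S, (s : ℕ) = a

/-- The largest absolute value of an eigenvalue of the adjacency matrix other than the first one,
where the eigenvalues are listed with multiplicity in nonincreasing order (`eigenvalues₀`). -/
noncomputable def lam {V : Type*} [Fintype V] [DecidableEq V] (G : SimpleGraph V)
    [DecidableRel G.Adj] : ℝ :=
  ⨆ i : {i : Fin (Fintype.card V) // 0 < (i : ℕ)}, |(G.isHermitian_adjMatrix ℝ).eigenvalues₀ i|

end CirculantExpander

open Finset

/-! ## Programs that run in polynomial time -/

namespace RAM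

/-! The eigenvalues of a circulant graph are the character sums over its connection set, so it
suffices to produce a symmetric set of `O(log n)` nonzero residues on which every nontrivial
character sum is at most `ε` times the size.

Let `b = level n`, so that `2 ^ b` has the order of `log n`, and let `R = 2 ^ (4 b)`. The connection
set consists of the residues `± v / p mod n`, where `v` runs over a set `A ⊆ {1, …, R - 1}` of
`O(b)` elements and `p` over a set of `O(2 ^ b / b)` primes in `(R, 4 R]` not dividing `n`. For
large `n` these residues are distinct and nonzero, so the degree is `O(log n)`
(`natCast_ne_neg_and_eq`). At a frequency `k ≠ 0` the prime `p` contributes `2 ∑ cos (2 π v y / n)`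
over `v ∈ A`, where `y ≡ k / p` is the residue of least absolute value.

If `|y| / n ≥ D / R`, the inner sum is `O(|A| / D)`, because `A` imitates the whole interval
(`abs_sum_cos_sample_le`). Otherwise `p y = k + n a` with `|a| ≤ 4 D`, so `p` divides one fixed
nonzero product of `8 D + 1` numbers of size `O(D n)`. This product has few prime factors above `R`,
so at most a fraction `1 / D` of the primes is bad (`card_bad_le`). Together the sum is at most `34
/ D` times the degree.

The set `A` is found by the method of conditional expectations. A random set of `O(log R)` elements
meets, with high probability, every arc `j v mod N < u`, `N = D R`, about as often as expected. An
exponential-moment potential certifies this, and choosing elements greedily keeps it low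
(`exists_low_potential`, `sample_spec`). Summation by parts passes from arcs to cosines. All
searches range over sets of size polynomial in `R`, hence in `log n`.

The finitely many `n` below a threshold get the complete graph, for which `λ = 1 = d / (n - 1)`. The
running time is handled by a small calculus of programs closed under arithmetic and bounded loops
(`Run.op`, `Run.fold`). -/

theorem bitLen_mono {a b : ℕ} (h : a ≤ b) : bitLen a ≤ bitLen b :=
  Nat.succ_le_succ (Nat.log_mono_right h)

theorem bitLen_le_iff {a k : ℕ} (hk : 1 ≤ k) : bitLen a ≤ k ↔ a < 2 ^ k := by
  rw [bitLen, Nat.add_one_le_iff]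
  rcases Nat.eq_zero_or_pos a with rfl | ha
  · simp; omega
  · exact Nat.log_lt_iff_lt_pow (by norm_num) ha.ne'

theorem lt_two_pow_bitLen (a : ℕ) : a < 2 ^ bitLen a :=
  (bitLen_le_iff (Nat.succ_pos _)).1 le_rfl

theorem one_le_bitLen (a : ℕ) : 1 ≤ bitLen a := Nat.succ_pos _

theorem bitLen_le_succ (a : ℕ) : bitLen a ≤ a + 1 :=
  Nat.succ_le_succ (Nat.log_le_self 2 a)

theorem bitLen_mul (a b : ℕ) : bitLen (a * b) ≤ bitLen a + bitLen b := by
  rw [bitLen_le_iff (by have := one_le_bitLen a; omega), pow_add]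
  exact Nat.mul_lt_mul'' (lt_two_pow_bitLen a) (lt_two_pow_bitLen b)

theorem bitLen_add (a b : ℕ) : bitLen (a + b) ≤ bitLen a + bitLen b := by
  rw [bitLen_le_iff (by have := one_le_bitLen a; omega), pow_add]
  have ha := lt_two_pow_bitLen a
  have hb := lt_two_pow_bitLen b
  nlinarith

theorem bitLen_eval (o : BinOp) (a b : ℕ) : bitLen (o.eval a b) ≤ bitLen a + bitLen b := by
  cases o
  · exact bitLen_add a b
  · exact (bitLen_mono (Nat.sub_le a b)).trans (Nat.le_add_right _ _)
  · exact bitLen_mul a b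
  · exact (bitLen_mono (Nat.div_le_self a b)).trans (Nat.le_add_right _ _)
  · exact (bitLen_mono (Nat.mod_le a b)).trans (Nat.le_add_right _ _)

theorem Exec.congr_out {p : Prog} {s : State} {t : ℕ} {m : ℕ → ℕ} {o o' : List ℕ}
    (h : Exec p s t ⟨m, o⟩) (ho : o = o') : Exec p s t ⟨m, o'⟩ := ho ▸ h

/-- A family of computation problems: the admissible parameters `x ∈ D`, their sizes, and the
requirement on the registers below `d` in which the data are stored. -/
structure Ctx (X : Type) where
  D : Set X
  sz : X → ℕ
  two_le : ∀ x, 2 ≤ sz x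
  d : ℕ
  holds : X → (ℕ → ℕ) → Prop
  congr : ∀ x m m', (∀ i < d, m' i = m i) → holds x m → holds x m'

namespace Ctx

variable {X : Type} {C : Ctx X}

/-- `f` is bounded by a power of the size. -/
def PolyBdd (C : Ctx X) (f : X → ℕ) : Prop := ∃ K, ∀ x ∈ C.D, f x ≤ C.sz x ^ K

theorem PolyBdd.mono {f g : X → ℕ} (hg : C.PolyBdd g) (h : ∀ x ∈ C.D, f x ≤ g x) :
    C.PolyBdd f :=
  hg.imp fun _ hK x hx => (h x hx).trans (hK x hx)

/-- Sizes are at least `2`, so a constant `c` lies below the `c`-th power of the size. For the same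
reason sums of polynomial bounds cost only one more power. -/
theorem PolyBdd.const (c : ℕ) : C.PolyBdd fun _ => c :=
  ⟨c, fun x _ => (Nat.lt_two_pow_self).le.trans (Nat.pow_le_pow_left (C.two_le x) c)⟩

theorem PolyBdd.mul {f g : X → ℕ} (hf : C.PolyBdd f) (hg : C.PolyBdd g) :
    C.PolyBdd fun x => f x * g x := by
  obtain ⟨K, hK⟩ := hf
  obtain ⟨M, hM⟩ := hg
  exact ⟨K + M, fun x hx => pow_add (C.sz x) K M ▸ Nat.mul_le_mul (hK x hx) (hM x hx)⟩

theorem PolyBdd.add {f g : X → ℕ} (hf : C.PolyBdd f) (hg : C.PolyBdd g) :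
    C.PolyBdd fun x => f x + g x := by
  obtain ⟨K, hK⟩ := hf
  obtain ⟨M, hM⟩ := hg
  refine ⟨max K M + 1, fun x hx => ?_⟩
  have h1 : 1 ≤ C.sz x := one_le_two.trans (C.two_le x)
  have hf := (hK x hx).trans (Nat.pow_le_pow_right h1 (le_max_left K M))
  have hg := (hM x hx).trans (Nat.pow_le_pow_right h1 (le_max_right K M))
  have h2 := C.two_le x
  rw [pow_succ]
  nlinarith

theorem PolyBdd.bitLen {f : X → ℕ} (hf : C.PolyBdd f) : C.PolyBdd fun x => bitLen (f x) :=
  (hf.add (PolyBdd.const 1)).mono fun x _ => bitLen_le_succ (f x)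

/-- For every register `r` outside the data there is a program that stores `f x` in `R_r`, appends
`L x` to the output, preserves the registers below `r`, and runs in polynomial time. -/
def Run (C : Ctx X) (f : X → ℕ) (L : X → List ℕ) : Prop :=
  (C.PolyBdd fun x => bitLen (f x)) ∧
  ∀ r, C.d ≤ r → ∃ (p : Prog) (T : X → ℕ), C.PolyBdd T ∧
    ∀ x ∈ C.D, ∀ s : State, C.holds x s.mem → ∃ (t : ℕ) (m : ℕ → ℕ),
      Exec p s t ⟨m, s.out ++ L x⟩ ∧ (∀ i < r, m i = s.mem i) ∧ m r = f x ∧ t ≤ T x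

/-- `f` is computable in polynomial time. -/
def Comp (C : Ctx X) (f : X → ℕ) : Prop := C.Run f fun _ => []

/-- `f` is computable in polynomial time and polynomially bounded. -/
def Small (C : Ctx X) (f : X → ℕ) : Prop := C.Comp f ∧ C.PolyBdd f

theorem Run.congr {f g : X → ℕ} {L M : X → List ℕ} (h : C.Run f L)
    (hf : ∀ x ∈ C.D, f x = g x) (hL : ∀ x ∈ C.D, L x = M x) : C.Run g M := by
  refine ⟨h.1.mono fun x hx => (congrArg RAM.bitLen (hf x hx)).ge, fun r hr => ?_⟩
  obtain ⟨p, T, hT, H⟩ := h.2 r hr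
  refine ⟨p, T, hT, fun x hx s hs => ?_⟩
  rw [← hf x hx, ← hL x hx]
  exact H x hx s hs

theorem Comp.congr {f g : X → ℕ} (h : C.Comp f) (hf : ∀ x ∈ C.D, f x = g x) : C.Comp g :=
  Run.congr h hf fun _ _ => rfl

theorem Comp.var {f : X → ℕ} {i : ℕ} (hf : C.PolyBdd fun x => RAM.bitLen (f x))
    (h : ∀ x m, C.holds x m → m i = f x) : C.Comp f := by
  refine ⟨hf, fun r hr => ⟨.assign (.reg r) .add (.reg i) (.const 0),
    fun x => RAM.bitLen i + RAM.bitLen (f x) + RAM.bitLen 0 + RAM.bitLen r + RAM.bitLen (f x),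
    ((((PolyBdd.const _).add hf).add (PolyBdd.const _)).add (PolyBdd.const _)).add hf,
    fun x hx s hs => ⟨_, _, (Exec.assign (.reg r) .add (.reg i) (.const 0) s).congr_out (by simp),
      fun j hj => ?_, ?_, ?_⟩⟩⟩
  · simp [Dest.addr, hj.ne]
  · simp [Dest.addr, BinOp.eval, Operand.val, h x s.mem hs]
  · simp [BinOp.eval, Operand.val, Operand.cost, Dest.cost, h x s.mem hs]

theorem Comp.const (c : ℕ) : C.Comp fun _ => c := by
  refine ⟨PolyBdd.const _, fun r hr => ⟨.assign (.reg r) .add (.const c) (.const 0),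
    fun x => RAM.bitLen c + RAM.bitLen 0 + RAM.bitLen r + RAM.bitLen c, PolyBdd.const _,
    fun x hx s hs => ⟨_, _, (Exec.assign (.reg r) .add (.const c) (.const 0) s).congr_out (by simp),
      fun j hj => ?_, ?_, ?_⟩⟩⟩
  · simp [Dest.addr, hj.ne]
  · simp [Dest.addr, BinOp.eval, Operand.val]
  · simp [BinOp.eval, Operand.val, Operand.cost, Dest.cost]

/-- The first value stays in `R_r` while the second is computed in `R_(r+1)` and above; the program
for the latter preserves everything below `r + 1`. -/
theorem Run.op (o : BinOp) {f g : X → ℕ} {L M : X → List ℕ} (hf : C.Run f L) (hg : C.Run g M) :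
    C.Run (fun x => o.eval (f x) (g x)) (fun x => L x ++ M x) := by
  refine ⟨(hf.1.add hg.1).mono fun x _ => bitLen_eval o _ _, fun r hr => ?_⟩
  obtain ⟨p, T, hT, hp⟩ := hf.2 r hr
  obtain ⟨q, U, hU, hq⟩ := hg.2 (r + 1) (by omega)
  refine ⟨.seq p (.seq q (.assign (.reg r) o (.reg r) (.reg (r + 1)))),
    fun x => T x + (U x + ((RAM.bitLen r + RAM.bitLen (f x)) +
      (RAM.bitLen (r + 1) + RAM.bitLen (g x)) + RAM.bitLen r +
        (RAM.bitLen (f x) + RAM.bitLen (g x)))),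
    hT.add (hU.add (((((PolyBdd.const _).add hf.1).add ((PolyBdd.const _).add hg.1)).add
      (PolyBdd.const _)).add (hf.1.add hg.1))), fun x hx s hs => ?_⟩
  obtain ⟨t₁, m₁, e₁, k₁, v₁, b₁⟩ := hp x hx s hs
  obtain ⟨t₂, m₂, e₂, k₂, v₂, b₂⟩ := hq x hx ⟨m₁, s.out ++ L x⟩
    (C.congr x _ _ (fun i hi => k₁ i (by omega)) hs)
  have w₁ : m₂ r = f x := (k₂ r (by omega)).trans v₁
  refine ⟨_, _, .seq e₁ (.seq e₂ ((Exec.assign (.reg r) o (.reg r) (.reg (r + 1)) _).congr_out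
    (List.append_assoc _ _ _))), fun i hi => ?_, ?_, ?_⟩
  · simp only [Dest.addr, Function.update_of_ne hi.ne]
    exact (k₂ i (by omega)).trans (k₁ i hi)
  · simp [Dest.addr, Operand.val, w₁, v₂]
  · have := bitLen_eval o (f x) (g x)
    simp only [Operand.cost, Operand.val, Dest.cost, w₁, v₂]
    omega

theorem Comp.op (o : BinOp) {f g : X → ℕ} (hf : C.Comp f) (hg : C.Comp g) :
    C.Comp fun x => o.eval (f x) (g x) := Run.op o hf hg

theorem Run.append {L M : X → List ℕ} (hf : C.Run (fun _ => 0) L) (hg : C.Run (fun _ => 0) M) :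
    C.Run (fun _ => 0) (fun x => L x ++ M x) := Run.op .add hf hg

theorem Comp.write {f : X → ℕ} (hf : C.Comp f) : C.Run (fun _ => 0) fun x => [f x] := by
  refine ⟨PolyBdd.const _, fun r hr => ?_⟩
  obtain ⟨p, T, hT, hp⟩ := hf.2 r hr
  refine ⟨.seq p (.seq (.write (.reg r)) (.assign (.reg r) .add (.const 0) (.const 0))),
    fun x => T x + (RAM.bitLen r + RAM.bitLen (f x) +
      (RAM.bitLen 0 + RAM.bitLen 0 + RAM.bitLen r + RAM.bitLen 0)),
    hT.add (((PolyBdd.const _).add hf.1).add (PolyBdd.const _)), fun x hx s hs => ?_⟩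
  obtain ⟨t₁, m₁, e₁, k₁, v₁, b₁⟩ := hp x hx s hs
  refine ⟨_, _, .seq e₁ (.seq (.write _ _) ((Exec.assign (.reg r) .add (.const 0) (.const 0)
    _).congr_out (by simp [Operand.val, v₁]))), fun i hi => ?_, ?_, ?_⟩
  · simp only [Dest.addr, Function.update_of_ne hi.ne]
    exact k₁ i hi
  · simp [Dest.addr, Operand.val, BinOp.eval]
  · simp only [Operand.cost, Operand.val, Dest.cost, BinOp.eval, v₁, add_zero]
    omega

/-- The context inside the body of a loop with `cnt x` rounds and accumulator `F x i`. -/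
def ext (C : Ctx X) (r : ℕ) (hr : C.d ≤ r) (cnt : X → ℕ) (F : X → ℕ → ℕ) : Ctx (X × ℕ) where
  D := {y | y.1 ∈ C.D ∧ y.2 < cnt y.1}
  sz y := C.sz y.1
  two_le y := C.two_le y.1
  d := r + 3
  holds y m := C.holds y.1 m ∧ m r = F y.1 y.2 ∧ m (r + 1) = y.2 ∧ m (r + 2) = cnt y.1
  congr y m m' h h' := ⟨C.congr y.1 m m' (fun i hi => h i (by omega)) h'.1,
    (h r (by omega)).trans h'.2.1, (h (r + 1) (by omega)).trans h'.2.2.1,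
    (h (r + 2) (by omega)).trans h'.2.2.2⟩

variable {r : ℕ} {hr : C.d ≤ r} {cnt : X → ℕ} {F : X → ℕ → ℕ}

theorem PolyBdd.lift {f : X → ℕ} (hf : C.PolyBdd f) :
    (C.ext r hr cnt F).PolyBdd fun y => f y.1 :=
  hf.imp fun _ hK y hy => hK y.1 hy.1

theorem Run.lift {f : X → ℕ} {L : X → List ℕ} (hf : C.Run f L) :
    (C.ext r hr cnt F).Run (fun y => f y.1) fun y => L y.1 := by
  refine ⟨hf.1.lift, fun q hq => ?_⟩
  obtain ⟨p, T, hT, hp⟩ := hf.2 q (le_trans (by simp only [ext]; omega) hq)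
  exact ⟨p, fun y => T y.1, hT.lift, fun y hy s hs => hp y.1 hy.1 s hs.1⟩

theorem Comp.lift {f : X → ℕ} (hf : C.Comp f) : (C.ext r hr cnt F).Comp fun y => f y.1 :=
  Run.lift hf

theorem Small.lift {f : X → ℕ} (hf : C.Small f) : (C.ext r hr cnt F).Small fun y => f y.1 :=
  ⟨hf.1.lift, hf.2.lift⟩

theorem Small.index (hc : C.PolyBdd cnt) : (C.ext r hr cnt F).Small fun y => y.2 := by
  have h : (C.ext r hr cnt F).PolyBdd fun y => y.2 := hc.lift.mono fun y hy => hy.2.le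
  exact ⟨Comp.var (i := r + 1) h.bitLen fun _ _ h => h.2.2.1, h⟩

theorem Comp.acc (h : (C.ext r hr cnt F).PolyBdd fun y => RAM.bitLen (F y.1 y.2)) :
    (C.ext r hr cnt F).Comp fun y => F y.1 y.2 :=
  Comp.var (i := r) h fun _ _ h => h.2.1

/-- The accumulator, counter and number of rounds occupy `R_r`, `R_(r+1)`, `R_(r+2)`; the body works
from `R_(r+3)` on and its result is copied back to `R_r`. The hypothesis on the body includes a
polynomial bound on the bit length of every new accumulator value, which excludes exponential growth
under iteration. -/
theorem Run.fold {L : X → ℕ → List ℕ} (h0 : C.Comp fun x => F x 0) (hc : C.Small cnt)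
    (hb : ∀ r hr, (C.ext r hr cnt F).Run (fun y => F y.1 (y.2 + 1)) fun y => L y.1 y.2) :
    C.Run (fun x => F x (cnt x)) fun x => (List.range (cnt x)).flatMap (L x) := by
  have hF : ∃ B : X → ℕ, C.PolyBdd B ∧ ∀ x ∈ C.D, ∀ i ≤ cnt x, RAM.bitLen (F x i) ≤ B x := by
    obtain ⟨K, hK⟩ := (hb C.d le_rfl).1
    refine ⟨fun x => RAM.bitLen (F x 0) + C.sz x ^ K, h0.1.add ⟨K, fun _ _ => le_rfl⟩,
      fun x hx i hi => ?_⟩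
    rcases i with _ | i
    · exact Nat.le_add_right _ _
    · exact (hK (x, i) ⟨hx, hi⟩).trans (Nat.le_add_left _ _)
  obtain ⟨B, hB, hFB⟩ := hF
  refine ⟨hB.mono fun x hx => hFB x hx _ le_rfl, fun r hr => ?_⟩
  obtain ⟨p, T, hT, hp⟩ := h0.2 r hr
  obtain ⟨q, U, hU, hq⟩ := hc.1.2 (r + 2) (by omega)
  obtain ⟨w, V, ⟨K, hV⟩, hw⟩ := (hb r hr).2 (r + 3) le_rfl
  -- the cost of testing the condition and of one round
  let cc : X → ℕ := fun x => RAM.bitLen (r + 1) + RAM.bitLen (cnt x) +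
    (RAM.bitLen (r + 2) + RAM.bitLen (cnt x))
  let rc : X → ℕ := fun x => cc x + (C.sz x ^ K +
    ((RAM.bitLen (r + 3) + B x + RAM.bitLen 0 + RAM.bitLen r + B x) +
    (RAM.bitLen (r + 1) + RAM.bitLen (cnt x) + RAM.bitLen 1 + RAM.bitLen (r + 1) +
      RAM.bitLen (cnt x))))
  have hcc : C.PolyBdd cc := ((PolyBdd.const _).add hc.1.1).add ((PolyBdd.const _).add hc.1.1)
  have hrc : C.PolyBdd rc := hcc.add (PolyBdd.add ⟨K, fun _ _ => le_rfl⟩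
    ((((((PolyBdd.const _).add hB).add (PolyBdd.const _)).add (PolyBdd.const _)).add hB).add
    (((((PolyBdd.const _).add hc.1.1).add (PolyBdd.const _)).add (PolyBdd.const _)).add hc.1.1)))
  let body : Prog := .seq w (.seq (.assign (.reg r) .add (.reg (r + 3)) (.const 0))
    (.assign (.reg (r + 1)) .add (.reg (r + 1)) (.const 1)))
  -- Induction on the number `k` of rounds still to run, with the counter at `i = cnt x - k`.
  have hloop : ∀ x ∈ C.D, ∀ k i, i + k = cnt x → ∀ s : State, C.holds x s.mem →
      s.mem r = F x i → s.mem (r + 1) = i → s.mem (r + 2) = cnt x → ∃ (t : ℕ) (m : ℕ → ℕ),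
      Exec (.loop (.reg (r + 1)) (.reg (r + 2)) body) s t
        ⟨m, s.out ++ (List.range' i k).flatMap (L x)⟩ ∧
      (∀ i < r, m i = s.mem i) ∧ m r = F x (cnt x) ∧ t ≤ k * rc x + cc x := by
    intro x hx k
    induction k with
    | zero =>
      intro i hi s hs h1 h2 h3
      refine ⟨_, s.mem, (Exec.loop_false (p := body) (s := s) (x := .reg (r + 1))
        (y := .reg (r + 2)) (by simp only [Operand.val, h2, h3]; omega)).congr_out (by simp),
        fun _ _ => rfl, ?_, ?_⟩
      · rw [h1, ← hi, add_zero]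
      · simp only [Operand.cost, h2, h3, cc]
        have : RAM.bitLen i ≤ RAM.bitLen (cnt x) := bitLen_mono (by omega)
        omega
    | succ k ih =>
      intro i hi s hs h1 h2 h3
      have hD : ((x, i) : X × ℕ) ∈ (C.ext r hr cnt F).D := ⟨hx, show i < cnt x by omega⟩
      obtain ⟨t₁, m₁, e₁, k₁, v₁, b₁⟩ := hw (x, i) hD s ⟨hs, h1, h2, h3⟩
      simp only at e₁ v₁ b₁
      have e₂ := Exec.assign (.reg r) .add (.reg (r + 3)) (.const 0)
        (⟨m₁, s.out ++ L x i⟩ : State)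
      simp only [Dest.addr, Operand.val, BinOp.eval, v₁, add_zero, Dest.cost,
        Operand.cost] at e₂
      have e₃ := Exec.assign (.reg (r + 1)) .add (.reg (r + 1)) (.const 1)
        (⟨Function.update m₁ r (F x (i + 1)), s.out ++ L x i⟩ : State)
      have u₁ : m₁ (r + 1) = i := (k₁ (r + 1) (by omega)).trans h2
      simp only [Dest.addr, Operand.val, BinOp.eval, Dest.cost, Operand.cost,
        Function.update_of_ne (show r + 1 ≠ r by omega), u₁] at e₃
      obtain ⟨t₄, m₄, e₄, k₄, v₄, b₄⟩ := ih (i + 1) (by omega)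
        ⟨Function.update (Function.update m₁ r (F x (i + 1))) (r + 1) (i + 1), s.out ++ L x i⟩
        (C.congr x s.mem _ (fun j hj => by
          have : j < r := by omega
          simp only [Function.update_of_ne (show j ≠ r + 1 by omega),
            Function.update_of_ne this.ne]
          exact k₁ j (by omega)) hs)
        (by simp) (by simp)
        (by simpa using (k₁ (r + 2) (by omega)).trans h3)
      refine ⟨_, m₄, (Exec.loop_true (x := .reg (r + 1)) (y := .reg (r + 2))
        (by simp only [Operand.val, h2, h3]; omega) (.seq e₁ (.seq e₂ e₃)) e₄).congr_out
        (by simp [List.range'_succ]), fun j hj => ?_, v₄, ?_⟩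
      · rw [k₄ j hj]
        simp only [Function.update_of_ne (show j ≠ r + 1 by omega), Function.update_of_ne hj.ne]
        exact k₁ j (by omega)
      · have g1 : RAM.bitLen i ≤ RAM.bitLen (cnt x) := bitLen_mono (by omega)
        have g2 : RAM.bitLen (i + 1) ≤ RAM.bitLen (cnt x) := bitLen_mono (by omega)
        have g3 := hFB x hx (i + 1) (by omega)
        have g4 := b₁.trans (hV (x, i) hD)
        have g5 : (C.ext r hr cnt F).sz (x, i) = C.sz x := rfl
        rw [g5] at g4
        have g6 : (k + 1) * rc x = rc x + k * rc x := by ring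
        rw [g6]
        simp only [Operand.cost, h2, h3]
        simp only [rc, cc] at b₄ ⊢
        omega
  refine ⟨.seq p (.seq q (.seq (.assign (.reg (r + 1)) .add (.const 0) (.const 0))
      (.loop (.reg (r + 1)) (.reg (r + 2)) body))),
    fun x => T x + (U x + ((RAM.bitLen 0 + RAM.bitLen 0 + RAM.bitLen (r + 1) + RAM.bitLen 0) +
      (cnt x * rc x + cc x))),
    hT.add (hU.add ((PolyBdd.const _).add ((hc.2.mul hrc).add hcc))), fun x hx s hs => ?_⟩
  obtain ⟨t₁, m₁, e₁, k₁, v₁, b₁⟩ := hp x hx s hs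
  obtain ⟨t₂, m₂, e₂, k₂, v₂, b₂⟩ := hq x hx ⟨m₁, s.out ++ []⟩
    (C.congr x _ _ (fun i hi => k₁ i (by omega)) hs)
  have e₃ := Exec.assign (.reg (r + 1)) .add (.const 0) (.const 0)
    (⟨m₂, s.out ++ [] ++ []⟩ : State)
  simp only [Dest.addr, Operand.val, BinOp.eval, Dest.cost, Operand.cost] at e₃
  obtain ⟨t₄, m₄, e₄, k₄, v₄, b₄⟩ := hloop x hx (cnt x) 0 (by omega)
    ⟨Function.update m₂ (r + 1) (0 + 0), s.out ++ [] ++ []⟩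
    (C.congr x s.mem _ (fun i hi => by
      simp only [Function.update_of_ne (show i ≠ r + 1 by omega)]
      exact (k₂ i (by omega)).trans (k₁ i (by omega))) hs)
    (by simpa using (k₂ r (by omega)).trans v₁) (by simp) (by simpa using v₂)
  refine ⟨_, m₄, (Exec.seq e₁ (.seq e₂ (.seq e₃ e₄))).congr_out
    (by simp [List.range_eq_range']), fun i hi => ?_, v₄, ?_⟩
  · rw [k₄ i hi]
    simp only [Function.update_of_ne (show i ≠ r + 1 by omega)]
    exact (k₂ i (by omega)).trans (k₁ i hi)
  · simp only [add_zero]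
    omega

end Ctx

end RAM

/-! ### Bounded sums, products, tests and quantifiers in polynomial time. -/

namespace RAM

theorem bitLen_sum_le {a : ℕ → ℕ} {B i : ℕ} (h : ∀ j < i, bitLen (a j) ≤ B) :
    bitLen (∑ j ∈ range i, a j) ≤ 1 + i * B := by
  induction i with
  | zero => simp [bitLen]
  | succ i ih =>
    rw [sum_range_succ, add_mul, one_mul, ← add_assoc]
    exact (bitLen_add _ _).trans (Nat.add_le_add (ih fun j hj => h j (by omega)) (h i (by omega)))

theorem bitLen_prod_le {a : ℕ → ℕ} {B i : ℕ} (h : ∀ j < i, bitLen (a j) ≤ B) :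
    bitLen (∏ j ∈ range i, a j) ≤ 1 + i * B := by
  induction i with
  | zero => simp [bitLen]
  | succ i ih =>
    rw [prod_range_succ, add_mul, one_mul, ← add_assoc]
    exact (bitLen_mul _ _).trans (Nat.add_le_add (ih fun j hj => h j (by omega)) (h i (by omega)))

namespace Ctx

variable {X : Type} {C : Ctx X} {f g cnt : X → ℕ} {P Q : X → Prop}

theorem Comp.add (hf : C.Comp f) (hg : C.Comp g) : C.Comp fun x => f x + g x := Comp.op .add hf hg
theorem Comp.sub (hf : C.Comp f) (hg : C.Comp g) : C.Comp fun x => f x - g x := Comp.op .sub hf hg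
theorem Comp.mul (hf : C.Comp f) (hg : C.Comp g) : C.Comp fun x => f x * g x := Comp.op .mul hf hg
theorem Comp.div (hf : C.Comp f) (hg : C.Comp g) : C.Comp fun x => f x / g x := Comp.op .div hf hg
theorem Comp.mod (hf : C.Comp f) (hg : C.Comp g) : C.Comp fun x => f x % g x := Comp.op .mod hf hg

theorem Small.const (c : ℕ) : C.Small fun _ => c := ⟨Comp.const c, PolyBdd.const c⟩
theorem Small.add (hf : C.Small f) (hg : C.Small g) : C.Small fun x => f x + g x :=
  ⟨hf.1.add hg.1, hf.2.add hg.2⟩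
theorem Small.mul (hf : C.Small f) (hg : C.Small g) : C.Small fun x => f x * g x :=
  ⟨hf.1.mul hg.1, hf.2.mul hg.2⟩

/-- The property `P` can be decided in polynomial time. -/
def Test (C : Ctx X) (P : X → Prop) : Prop := open Classical in C.Comp fun x => if P x then 1 else 0

/-- Truncated subtraction makes `1 - (1 - (g - f))` the indicator of `f < g`. -/
theorem Test.lt (hf : C.Comp f) (hg : C.Comp g) : C.Test fun x => f x < g x :=
  ((Comp.const 1).sub ((Comp.const 1).sub (hg.sub hf))).congr fun x _ => by
    split_ifs with h <;> omega

theorem Test.not (hP : C.Test P) : C.Test fun x => ¬ P x :=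
  ((Comp.const 1).sub hP).congr fun x _ => by
    by_cases h : P x <;> simp [h]

theorem Test.and (hP : C.Test P) (hQ : C.Test Q) : C.Test fun x => P x ∧ Q x :=
  (Comp.mul hP hQ).congr fun x _ => by
    by_cases h : P x <;> by_cases h' : Q x <;> simp [h, h']

theorem Test.congr (hP : C.Test P) (h : ∀ x ∈ C.D, P x ↔ Q x) : C.Test Q :=
  Comp.congr hP fun x hx => by classical exact if_congr (h x hx) rfl rfl

theorem Test.le (hf : C.Comp f) (hg : C.Comp g) : C.Test fun x => f x ≤ g x :=
  (Test.lt hg hf).not.congr fun _ _ => not_lt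

theorem Test.eq (hf : C.Comp f) (hg : C.Comp g) : C.Test fun x => f x = g x :=
  ((Test.le hf hg).and (Test.le hg hf)).congr fun _ _ => le_antisymm_iff.symm

/-- Both branches are evaluated and combined arithmetically with the indicators of `P` and its
negation. -/
theorem Test.ite [DecidablePred P] (hP : C.Test P) (hf : C.Comp f) (hg : C.Comp g) :
    C.Comp fun x => if P x then f x else g x :=
  ((Comp.mul hP hf).add (Comp.mul hP.not hg)).congr fun x _ => by
    by_cases h : P x <;> simp [h]

theorem Test.small [DecidablePred P] (hP : C.Test P) : C.Small fun x => if P x then 1 else 0 :=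
  ⟨hP.ite (Comp.const 1) (Comp.const 0), (PolyBdd.const 1).mono fun _ _ => by split_ifs <;> simp⟩

/-- The size bound concerns the summand alone, so it can be read off from any choice of registers
and accumulator, here the zero accumulator. -/
theorem bits_le {g : X → ℕ → ℕ}
    (hg : ∀ r hr F, (C.ext r hr cnt F).Comp fun y => g y.1 y.2) :
    ∃ K, ∀ x ∈ C.D, ∀ i < cnt x, RAM.bitLen (g x i) ≤ C.sz x ^ K :=
  (hg C.d le_rfl fun _ _ => 0).1.imp fun _ hK x hx i hi => hK (x, i) ⟨hx, hi⟩

/-- A fold whose accumulator is the partial sum; its bit length is at most one plus the number of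
terms times the largest bit length of a term. -/
theorem Comp.sum {g : X → ℕ → ℕ} (hc : C.Small cnt)
    (hg : ∀ r hr F, (C.ext r hr cnt F).Comp fun y => g y.1 y.2) :
    C.Comp fun x => ∑ i ∈ range (cnt x), g x i := by
  obtain ⟨K, hK⟩ := bits_le hg
  refine Run.congr (Run.fold (F := fun x i => ∑ j ∈ range i, g x j) (L := fun _ _ => [])
    (by simpa using Comp.const 0) hc fun r hr => ?_) (fun _ _ => rfl) (by simp)
  simp only [sum_range_succ]
  refine Comp.add (Comp.acc (.mono (.lift (f := fun x => 1 + cnt x * C.sz x ^ K) (.add (.const 1)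
    (hc.2.mul ⟨K, fun _ _ => le_rfl⟩))) fun y hy => ?_)) (hg r hr _)
  refine (bitLen_sum_le fun j hj => hK y.1 hy.1 j (hj.trans hy.2)).trans ?_
  gcongr
  exact hy.2.le

theorem Comp.prod {g : X → ℕ → ℕ} (hc : C.Small cnt)
    (hg : ∀ r hr F, (C.ext r hr cnt F).Comp fun y => g y.1 y.2) :
    C.Comp fun x => ∏ i ∈ range (cnt x), g x i := by
  obtain ⟨K, hK⟩ := bits_le hg
  refine Run.congr (Run.fold (F := fun x i => ∏ j ∈ range i, g x j) (L := fun _ _ => [])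
    (by simpa using Comp.const 1) hc fun r hr => ?_) (fun _ _ => rfl) (by simp)
  simp only [prod_range_succ]
  refine Comp.mul (Comp.acc (.mono (.lift (f := fun x => 1 + cnt x * C.sz x ^ K) (.add (.const 1)
    (hc.2.mul ⟨K, fun _ _ => le_rfl⟩))) fun y hy => ?_)) (hg r hr _)
  refine (bitLen_prod_le fun j hj => hK y.1 hy.1 j (hj.trans hy.2)).trans ?_
  gcongr
  exact hy.2.le

/-- The exponent must be `Small`, since it is both the number of rounds and a factor in the bit
length of the result. -/
theorem Comp.pow (hf : C.Comp f) (hc : C.Small cnt) : C.Comp fun x => f x ^ cnt x :=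
  (Comp.prod (g := fun x _ => f x) hc fun _ _ _ => hf.lift).congr fun x _ => by simp

theorem Test.all {P : X → ℕ → Prop} (hc : C.Small cnt)
    (hP : ∀ r hr F, (C.ext r hr cnt F).Test fun y => P y.1 y.2) :
    C.Test fun x => ∀ i < cnt x, P x i := by
  classical
  refine (Test.eq (Comp.sum (g := fun x i => if P x i then 0 else 1) hc fun r hr F =>
    (hP r hr F).ite (Comp.const 0) (Comp.const 1)) (Comp.const 0)).congr fun x _ => ?_
  simp [sum_eq_zero_iff]

theorem Run.flatMap {L : X → ℕ → List ℕ} (hc : C.Small cnt)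
    (hL : ∀ r hr F, (C.ext r hr cnt F).Run (fun _ => 0) fun y => L y.1 y.2) :
    C.Run (fun _ => 0) fun x => (List.range (cnt x)).flatMap (L x) :=
  Run.fold (F := fun _ _ => 0) (Comp.const 0) hc fun r hr => hL r hr _

/-- Conditional output is a loop whose number of rounds is the indicator of `P`. -/
theorem Run.ite [DecidablePred P] {L : X → List ℕ} (hP : C.Test P) (hL : C.Run (fun _ => 0) L) :
    C.Run (fun _ => 0) fun x => if P x then L x else [] :=
  (Run.flatMap (L := fun x _ => L x) hP.small fun _ _ _ => hL.lift).congr (fun _ _ => rfl)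
    fun x _ => by by_cases h : P x <;> simp [h]

end Ctx

end RAM

/-! ## The algorithm -/

namespace CirculantExpander

/-- The `v`-th binary digit of `S`. -/
def bit (S v : ℕ) : ℕ := S / 2 ^ v % 2

/-- For `e = 0` the indicator of `j * v mod N < u`, for `e = 1` that of the complement. -/
def arcInd (N j u e v : ℕ) : ℕ := if j * v % N < u then 1 - e else e

/-- The factor that `v` contributes to the potential of the test `(j, u, e)`; its mean over
`v < R` is `D * R`. -/
def arcWeight (D R N j u e v : ℕ) : ℕ :=
  D * R + R * arcInd N j u e v - ∑ w ∈ range R, arcInd N j u e w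

/-- The potential of the subset of `{0, …, R - 1}` with the characteristic bits `S`. -/
def potential (D R N S : ℕ) : ℕ :=
  ∑ j ∈ range N, ∑ u ∈ range (N + 1), ∑ e ∈ range 2, ∏ v ∈ range R,
    if bit S v = 1 then arcWeight D R N j u e v else 1

/-- `v` is a new nonzero element that keeps the potential low. -/
abbrev Improves (D R N S v : ℕ) : Prop :=
  (0 < v ∧ bit S v = 0) ∧
    D * D * potential D R N (S + 2 ^ v) ≤ (D * D + 1) * (D * R) * potential D R N S

/-- The first `v < R` that improves `S`. -/
def pick (D R N S : ℕ) : ℕ :=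
  ∑ i ∈ range R, if ∀ v < i + 1, ¬ Improves D R N S v then 1 else 0

/-- The characteristic bits of the sample after `i` greedy steps. -/
def sampleCode (D R N : ℕ) : ℕ → ℕ
  | 0 => 0
  | i + 1 => sampleCode D R N i + 2 ^ pick D R N (sampleCode D R N i)

/-- `c` has no divisor in `{2, …, c - 1}` and does not divide `n`. -/
abbrev Usable (n c : ℕ) : Prop := (∀ i < c, ¬ (2 ≤ i ∧ c % i = 0)) ∧ ¬ n % c = 0

/-- `c` is one of the first `m` usable numbers above `R`. -/
abbrev Selected (R m n c : ℕ) : Prop :=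
  (R < c ∧ Usable n c) ∧ (∑ i ∈ range c, if R < i ∧ Usable n i then 1 else 0) < m

/-- The inverse of `c` modulo `n`. -/
def modInv (n c : ℕ) : ℕ :=
  ∑ j ∈ range c, if (1 + n * j) % c = 0 then (1 + n * j) / c else 0

/-- The elements `± v / c mod n` for `v` in the sample and `c` selected. -/
def expanderList (R m S n : ℕ) : List ℕ :=
  (List.range (4 * R + 1)).flatMap fun c =>
    if Selected R m n c then
      (List.range R).flatMap fun v =>
        if bit S v = 1 then [v * modInv n c % n] ++ [n - v * modInv n c % n] else []
    else []

/-- The length of the range from which the sample is drawn. -/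
def rangeLen (b : ℕ) : ℕ := 2 ^ b * 2 ^ b * (2 ^ b * 2 ^ b)

/-- The output of the algorithm for `2 ^ 2 ^ (b - 1) ≤ n < 2 ^ 2 ^ b`. -/
def outputList (D τ μ b₀ b n : ℕ) : List ℕ :=
  ((List.range (if b < b₀ then n - 1 else 0)).flatMap fun i => [i + 1]) ++
    if b₀ ≤ b then
      expanderList (rangeLen b) (μ * (2 ^ b / b))
        (sampleCode D (rangeLen b) (D * rangeLen b) (τ * b)) n
    else []

end CirculantExpander

/-! ### The ingredients of the algorithm run in polynomial time. -/

namespace RAM.Ctx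

open CirculantExpander

variable {X : Type} {C : Ctx X} {D : ℕ} {R N S n c m j u e v b : X → ℕ}

theorem Comp.bit (hS : C.Comp S) (hv : C.Small v) : C.Comp fun x => bit (S x) (v x) :=
  (hS.div ((Comp.const 2).pow hv)).mod (Comp.const 2)

theorem Comp.arcInd (hN : C.Comp N) (hj : C.Comp j) (hu : C.Comp u) (he : C.Comp e)
    (hv : C.Comp v) : C.Comp fun x => arcInd (N x) (j x) (u x) (e x) (v x) :=
  (Test.lt ((hj.mul hv).mod hN) hu).ite ((Comp.const 1).sub he) he

theorem Comp.arcWeight (hR : C.Small R) (hN : C.Comp N) (hj : C.Comp j)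
    (hu : C.Comp u) (he : C.Comp e) (hv : C.Comp v) :
    C.Comp fun x => arcWeight D (R x) (N x) (j x) (u x) (e x) (v x) :=
  ((((Comp.const D).mul hR.1).add (hR.1.mul (.arcInd hN hj hu he hv)))).sub
    (Comp.sum (g := fun x w => CirculantExpander.arcInd (N x) (j x) (u x) (e x) w) hR
      fun _ _ _ => .arcInd hN.lift hj.lift hu.lift he.lift (Small.index hR.2).1)

/-- `R` and `N` bound loops and must be `Small`. The code `S` may have about `R` binary digits and
is only `Comp`. -/
theorem Comp.potential (hR : C.Small R) (hN : C.Small N) (hS : C.Comp S) :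
    C.Comp fun x => potential D (R x) (N x) (S x) := by
  refine Comp.sum hN fun r₁ hr₁ F₁ => ?_
  refine Comp.sum (hN.lift.add (.const 1)) fun r₂ hr₂ F₂ => ?_
  refine Comp.sum (.const 2) fun r₃ hr₃ F₃ => ?_
  refine Comp.prod hR.lift.lift.lift fun r₄ hr₄ F₄ => ?_
  have hv := Small.index (r := r₄) (hr := hr₄) (F := F₄) hR.2.lift.lift.lift
  exact (Test.eq (.bit hS.lift.lift.lift.lift hv) (.const 1)).ite
    (.arcWeight hR.lift.lift.lift.lift hN.1.lift.lift.lift.lift (Small.index hN.2).1.lift.lift.lift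
      (Small.index (hN.lift.add (.const 1)).2).1.lift.lift (Small.index (.const 2)).1.lift hv.1)
    (.const 1)

theorem Test.improves (hR : C.Small R) (hN : C.Small N) (hS : C.Comp S) (hv : C.Small v) :
    C.Test fun x => Improves D (R x) (N x) (S x) (v x) :=
  (Test.and (.lt (.const 0) hv.1) (.eq (.bit hS hv) (.const 0))).and
    (.le (.mul (.const (D * D)) (.potential hR hN (hS.add (.pow (.const 2) hv))))
      (.mul (.mul (.const (D * D + 1)) (.mul (.const D) hR.1)) (.potential hR hN hS)))

theorem pick_le (D R N S : ℕ) : pick D R N S ≤ R :=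
  (sum_le_card_nsmul _ _ 1 fun _ _ => by split_ifs <;> simp).trans (by simp)

theorem Small.pick (hR : C.Small R) (hN : C.Small N) (hS : C.Comp S) :
    C.Small fun x => pick D (R x) (N x) (S x) := by
  refine ⟨Comp.sum hR fun r₁ hr₁ F₁ => Test.ite ?_ (.const 1) (.const 0),
    hR.2.mono fun x _ => pick_le _ _ _ _⟩
  have hi := Small.index (r := r₁) (hr := hr₁) (F := F₁) hR.2
  exact Test.all (hi.add (.const 1)) fun r₂ hr₂ F₂ => Test.not
    (Test.improves hR.lift.lift hN.lift.lift hS.lift.lift (Small.index (hi.add (.const 1)).2))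

/-- A crude bound, valid even when no element improves and `pick` takes its default value `R`. It is
needed only for the bit length of the accumulator. -/
theorem sampleCode_le (D R N i : ℕ) : sampleCode D R N i ≤ i * 2 ^ R := by
  induction i with
  | zero => simp [sampleCode]
  | succ i ih =>
    rw [sampleCode, add_mul, one_mul]
    exact Nat.add_le_add ih (Nat.pow_le_pow_right two_pos (pick_le _ _ _ _))

theorem Comp.sampleCode (hR : C.Small R) (hN : C.Small N) (hc : C.Small c) :
    C.Comp fun x => sampleCode D (R x) (N x) (c x) := by
  refine Run.congr (Run.fold (F := fun x i => CirculantExpander.sampleCode D (R x) (N x) i)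
    (L := fun _ _ => []) (Comp.const 0) hc fun r hr => ?_) (fun _ _ => rfl) (by simp)
  have hacc := Comp.acc (C := C) (r := r) (hr := hr) (cnt := c)
    (F := fun x i => CirculantExpander.sampleCode D (R x) (N x) i)
    (.mono (.lift (f := fun x => RAM.bitLen (c x) + (R x + 1))
      (.add hc.2.bitLen (hR.2.add (.const 1)))) fun y hy => ?_)
  · exact hacc.add (.pow (.const 2) (.pick hR.lift hN.lift hacc))
  · refine (bitLen_mono (sampleCode_le _ _ _ _)).trans ((bitLen_mul _ _).trans ?_)
    exact Nat.add_le_add (bitLen_mono hy.2.le) ((bitLen_le_iff (by omega)).2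
      (Nat.pow_lt_pow_right one_lt_two (by omega)))

theorem Test.usable (hn : C.Comp n) (hc : C.Small c) : C.Test fun x => Usable (n x) (c x) :=
  Test.and (.all hc fun _ _ _ => .not (.and (.le (.const 2) (Small.index hc.2).1)
    (.eq (.mod hc.1.lift (Small.index hc.2).1) (.const 0)))) (.not (.eq (.mod hn hc.1) (.const 0)))

theorem Test.selected (hR : C.Comp R) (hm : C.Comp m) (hn : C.Comp n) (hc : C.Small c) :
    C.Test fun x => Selected (R x) (m x) (n x) (c x) := by
  refine Test.and (.and (.lt hR hc.1) (.usable hn hc)) (.lt (Comp.sum hc fun r hr F =>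
    Test.ite ?_ (.const 1) (.const 0)) hm)
  exact Test.and (.lt hR.lift (Small.index hc.2).1) (.usable hn.lift (Small.index hc.2))

theorem Comp.modInv (hn : C.Comp n) (hc : C.Small c) : C.Comp fun x => modInv (n x) (c x) := by
  refine Comp.sum hc fun r hr F => ?_
  have h : (C.ext r hr c F).Comp fun y => 1 + n y.1 * y.2 :=
    (Comp.const 1).add (hn.lift.mul (Small.index hc.2).1)
  exact Test.ite (.eq (h.mod hc.1.lift) (.const 0)) (h.div hc.1.lift) (.const 0)

theorem Run.expanderList (hR : C.Small R) (hm : C.Comp m) (hS : C.Comp S) (hn : C.Comp n) :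
    C.Run (fun _ => 0) fun x => expanderList (R x) (m x) (S x) (n x) := by
  have hR4 : C.Small fun x => 4 * R x + 1 := ((Small.const 4).mul hR).add (.const 1)
  refine Run.flatMap hR4 fun r₁ hr₁ F₁ => ?_
  have hc := Small.index (r := r₁) (hr := hr₁) (F := F₁) hR4.2
  refine Run.ite (Test.selected hR.1.lift hm.lift hn.lift hc) (Run.flatMap hR.lift
    fun r₂ hr₂ F₂ => ?_)
  have hv := Small.index (r := r₂) (hr := hr₂) (F := F₂) hR.2.lift
  have hx := (hv.1.mul (Comp.modInv hn.lift hc).lift).mod hn.lift.lift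
  exact Run.ite (Test.eq (.bit hS.lift.lift hv) (.const 1))
    (Run.append (Comp.write hx) (Comp.write (hn.lift.lift.sub hx)))

theorem Run.outputList (τ μ b₀ : ℕ) (hn : C.Comp n) (hb : C.Small b)
    (h2b : C.PolyBdd fun x => 2 ^ b x) (h : ∀ x ∈ C.D, n x < 2 ^ 2 ^ b x) :
    C.Run (fun _ => 0) fun x => outputList D τ μ b₀ (b x) (n x) := by
  have hZ : C.Small fun x => 2 ^ b x := ⟨.pow (.const 2) hb, h2b⟩
  have hR : C.Small fun x => rangeLen (b x) := (hZ.mul hZ).mul (hZ.mul hZ)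
  have hk : C.Small fun x => if b x < b₀ then n x - 1 else 0 := by
    refine ⟨Test.ite (.lt hb.1 (.const b₀)) (hn.sub (.const 1)) (.const 0),
      -- In the complete-graph branch `b < b₀` forces `n < 2 ^ 2 ^ b₀`, so listing all nonzero
      -- residues takes a bounded number of rounds.
      (PolyBdd.const (2 ^ 2 ^ b₀)).mono fun x hx => ?_⟩
    split_ifs with hlt
    · exact ((Nat.sub_le _ _).trans (h x hx).le).trans
        (Nat.pow_le_pow_right two_pos (Nat.pow_le_pow_right two_pos hlt.le))
    · exact Nat.zero_le _
  exact Run.append (Run.flatMap hk fun _ _ _ =>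
      Comp.write (.add (Small.index hk.2).1 (.const 1)))
    (Run.ite (Test.le (.const b₀) hb.1) (.expanderList hR ((Comp.const μ).mul (hZ.1.div hb.1))
      (.sampleCode hR ((Small.const D).mul hR) ((Small.const τ).mul hb)) hn))

end RAM.Ctx

/-! ### The double logarithm of the input and the complete program. -/

namespace CirculantExpander

/-- The least `b` with `n < 2 ^ 2 ^ b`. -/
def level (n : ℕ) : ℕ := Nat.log 2 (Nat.log 2 n) + 1

theorem lt_two_pow_level (n : ℕ) : n < 2 ^ 2 ^ level n :=
  (Nat.lt_pow_succ_log_self one_lt_two n).trans_le (Nat.pow_le_pow_right two_pos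
    (Nat.succ_le_of_lt (Nat.lt_pow_succ_log_self one_lt_two _)))

theorem two_pow_two_pow_le {n i : ℕ} (hn : 2 ≤ n) (hi : i < level n) : 2 ^ 2 ^ i ≤ n := by
  have h1 : Nat.log 2 n ≠ 0 := (Nat.log_pos one_lt_two hn).ne'
  exact Nat.pow_le_of_le_log (by omega) (Nat.pow_le_of_le_log h1 (Nat.le_of_lt_succ hi))

theorem two_pow_level_le {n : ℕ} (hn : 2 ≤ n) : 2 ^ level n ≤ 2 * Nat.log 2 n := by
  rw [level, pow_succ, mul_comm]
  exact Nat.mul_le_mul_left 2 (Nat.pow_log_le_self 2 (Nat.log_pos one_lt_two hn).ne')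

end CirculantExpander

namespace RAM

open CirculantExpander

/-- The context in which `R_0` holds the input `n` and `R_1` holds `level n`. -/
def levelCtx : Ctx ℕ where
  D := {n | 2 ≤ n}
  sz n := 2 * bitLen n
  two_le n := by have := one_le_bitLen n; omega
  d := 2
  holds n m := m 0 = n ∧ m 1 = level n
  congr n m m' h h' := ⟨(h 0 (by omega)).trans h'.1, (h 1 (by omega)).trans h'.2⟩

theorem polyBdd_two_pow_level : levelCtx.PolyBdd fun n => 2 ^ level n :=
  ⟨1, fun n hn => by
    rw [pow_one]
    exact (two_pow_level_le hn).trans (Nat.mul_le_mul_left 2 (Nat.le_succ _))⟩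

theorem polyBdd_level : levelCtx.PolyBdd level :=
  polyBdd_two_pow_level.mono fun _ _ => Nat.lt_two_pow_self.le

/-- Repeated squaring, which counts the rounds in `R_1`. -/
def squareLoop : Prog :=
  .loop (.reg 2) (.reg 3) (.seq (.assign (.reg 2) .mul (.reg 2) (.reg 2))
    (.assign (.reg 1) .add (.reg 1) (.const 1)))

/-- The register `R_2` runs through `2 ^ 2 ^ i`. Since `R_3` holds `n + 1`, the loop continues
exactly while this number is at most `n`, that is, for `i < level n`. -/
theorem exec_squareLoop {n : ℕ} (hn : 2 ≤ n) (k i : ℕ) (hi : i + k = level n) (s : State)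
    (h0 : s.mem 0 = n) (h1 : s.mem 1 = i) (h2 : s.mem 2 = 2 ^ 2 ^ i) (h3 : s.mem 3 = n + 1) :
    ∃ (t : ℕ) (m : ℕ → ℕ), Exec squareLoop s t ⟨m, s.out⟩ ∧ m 0 = n ∧ m 1 = level n ∧
      t ≤ (k + 1) * (100 + 100 * bitLen n + 100 * bitLen (level n)) := by
  have b1 : bitLen (n + 1) ≤ bitLen n + 1 := bitLen_add n 1
  have c1 : bitLen 1 = 1 := by decide
  have c2 : bitLen 2 = 2 := by decide
  have c3 : bitLen 3 = 2 := by decide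
  induction k generalizing i s with
  | zero =>
    obtain rfl : i = level n := by omega
    have hlt := lt_two_pow_level n
    refine ⟨_, s.mem, Exec.loop_false ?_, h0, h1, ?_⟩
    · simp only [Operand.val, h2, h3]
      omega
    -- The final value of `R_2` exceeds `n`, but it is the square of a number at most `n`, so its
    -- bit length is at most `2 * bitLen n`.
    · have := bitLen_mul (2 ^ 2 ^ (level n - 1)) (2 ^ 2 ^ (level n - 1))
      rw [← pow_add, ← two_mul, ← pow_succ', Nat.sub_add_cancel (show 1 ≤ level n from Nat.succ_pos _)] at this
      have := bitLen_mono (two_pow_two_pow_le hn (Nat.sub_lt (Nat.succ_pos _) one_pos :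
        level n - 1 < level n))
      simp only [Operand.cost, h2, h3]
      omega
  | succ k ih =>
    have hle := two_pow_two_pow_le hn (show i < level n by omega)
    have e₂ := Exec.assign (.reg 2) .mul (.reg 2) (.reg 2) s
    simp only [Dest.addr, Operand.val, BinOp.eval, Dest.cost, Operand.cost, h2] at e₂
    have e₃ := Exec.assign (.reg 1) .add (.reg 1) (.const 1)
      ⟨Function.update s.mem 2 (2 ^ 2 ^ i * 2 ^ 2 ^ i), s.out⟩
    simp only [Dest.addr, Operand.val, BinOp.eval, Dest.cost, Operand.cost,
      Function.update_of_ne (show (1 : ℕ) ≠ 2 by omega), h1] at e₃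
    obtain ⟨t, m, e₄, m0, m1, ht⟩ := ih (i + 1) (by omega)
      ⟨Function.update (Function.update s.mem 2 (2 ^ 2 ^ i * 2 ^ 2 ^ i)) 1 (i + 1), s.out⟩
      (by simpa using h0) (by simp) (by simp [pow_succ, pow_mul]) (by simpa using h3)
    refine ⟨_, m, Exec.loop_true ?_ (.seq e₂ e₃) e₄, m0, m1, ?_⟩
    · simp only [Operand.val, h2, h3]
      omega
    · have g1 := bitLen_mul (2 ^ 2 ^ i) (2 ^ 2 ^ i)
      have g2 := bitLen_mono hle
      have g3 := bitLen_mono (show i + 1 ≤ level n by omega)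
      have g4 := bitLen_mono (show i ≤ level n by omega)
      rw [show k + 1 + 1 = 1 + (k + 1) by omega, add_mul (1 : ℕ), one_mul]
      simp only [Operand.cost, h2, h3]
      have := one_le_bitLen n
      omega

theorem exists_prog_outputList (D τ μ b₀ : ℕ) :
    ∃ (p : Prog) (K k : ℕ), ∀ n : ℕ, 2 ≤ n → ∃ t : ℕ,
      Outputs p n t (outputList D τ μ b₀ (level n) n) ∧ (t : ℝ) ≤ K * Real.logb 2 n ^ k := by
  have hn : levelCtx.Comp fun n => n :=
    .var (i := 0) ⟨1, fun n _ => by rw [pow_one]; exact Nat.le_mul_of_pos_left _ two_pos⟩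
      fun _ _ h => h.1
  have hb : levelCtx.Small level :=
    ⟨.var (i := 1) polyBdd_level.bitLen fun _ _ h => h.2, polyBdd_level⟩
  obtain ⟨p, T, hT, hp⟩ := (Ctx.Run.outputList (D := D) τ μ b₀ hn hb polyBdd_two_pow_level
    fun n _ => lt_two_pow_level n).2 2 le_rfl
  obtain ⟨K, hK⟩ : levelCtx.PolyBdd fun n => (100 * bitLen n + 100) +
      ((level n + 1) * (100 + 100 * bitLen n + 100 * bitLen (level n)) + T n) := by
    have h1 : levelCtx.PolyBdd fun n => bitLen n := hn.1
    exact ((Ctx.PolyBdd.mul (.const _) h1).add (.const _)).add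
      (((polyBdd_level.add (.const 1)).mul (((Ctx.PolyBdd.const _).add
        ((Ctx.PolyBdd.const _).mul h1)).add ((Ctx.PolyBdd.const _).mul polyBdd_level.bitLen))).add
        hT)
  refine ⟨.seq (.assign (.reg 2) .add (.const 2) (.const 0))
    (.seq (.assign (.reg 3) .add (.reg 0) (.const 1)) (.seq squareLoop p)), 4 ^ K, K,
    fun n h2n => ?_⟩
  have e₁ := Exec.assign (.reg 2) .add (.const 2) (.const 0) (init n)
  have e₂ := Exec.assign (.reg 3) .add (.reg 0) (.const 1)
    ⟨Function.update (init n).mem 2 2, []⟩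
  simp only [Dest.addr, Operand.val, BinOp.eval, Dest.cost, Operand.cost, init, add_zero,
    Function.update_of_ne (show (0 : ℕ) ≠ 2 by omega), if_true] at e₁ e₂
  obtain ⟨t₃, m₃, e₃, z₃, o₃, b₃⟩ := exec_squareLoop h2n (level n) 0 (by omega)
    ⟨Function.update (Function.update (fun i => if i = 0 then n else 0) 2 2) 3 (n + 1), []⟩
    (by simp) (by simp) (by simp) (by simp)
  obtain ⟨t₄, m₄, e₄, -, -, b₄⟩ := hp n h2n ⟨m₃, []⟩ ⟨z₃, o₃⟩
  refine ⟨_, ⟨_, .seq e₁ (.seq e₂ (.seq e₃ e₄)), rfl⟩, ?_⟩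
  -- The size in `levelCtx` is `2 * bitLen n`. As `Nat.log 2 n ≥ 1`, this is at most `4 log₂ n`,
  -- whence the constant `4 ^ K`.
  have hlog : ((2 * bitLen n : ℕ) : ℝ) ≤ 4 * Real.logb 2 n := by
    have h1 : (Nat.log 2 n : ℝ) ≤ Real.logb 2 n := Real.natLog_le_logb n 2
    have h2 : (1 : ℝ) ≤ Nat.log 2 n := by exact_mod_cast Nat.log_pos one_lt_two h2n
    simp only [bitLen]
    push_cast
    linarith
  refine le_trans (b := (((2 * bitLen n) ^ K : ℕ) : ℝ)) ?_ ?_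
  · refine Nat.cast_le.2 (le_trans ?_ (hK n h2n))
    have b1 : bitLen (n + 1) ≤ bitLen n + 1 := bitLen_add n 1
    have c0 : bitLen 0 = 1 := by decide
    have c1 : bitLen 1 = 1 := by decide
    have c2 : bitLen 2 = 2 := by decide
    have c3 : bitLen 3 = 2 := by decide
    beta_reduce
    omega
  · push_cast at hlog ⊢
    rw [← mul_pow]
    gcongr

end RAM

/-! ## Eigenvalues of circulant graphs -/

namespace CirculantExpander

open ZMod
open scoped ZMod

section Fourier

variable {N : ℕ} [NeZero N]

theorem dft_sum_translate (S : Finset (ZMod N)) (Φ : ZMod N → ℂ) (k : ZMod N) :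
    𝓕 (fun x => ∑ s ∈ S, Φ (x + s)) k = (∑ s ∈ S, stdAddChar (s * k)) * 𝓕 Φ k := by
  simp only [dft_apply, smul_eq_mul, mul_sum, sum_mul]
  rw [sum_comm]
  refine (sum_congr rfl fun s _ => ?_).trans sum_comm.symm
  rw [← Equiv.sum_comp (Equiv.addRight (-s))]
  refine sum_congr rfl fun x _ => ?_
  rw [← mul_assoc, ← AddChar.map_add_eq_mul]
  simp only [Equiv.coe_addRight, neg_add_cancel_right]
  congr 2
  ring

theorem eq_const_of_dft_eq_zero {Φ : ZMod N → ℂ} (h : ∀ k ≠ 0, 𝓕 Φ k = 0) (x y : ZMod N) :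
    Φ x = Φ y := by
  have key : ∀ z, Φ z = (N : ℂ)⁻¹ * 𝓕 Φ 0 := fun z => by
    conv_lhs => rw [← dft.symm_apply_apply Φ]
    rw [invDFT_apply, Fintype.sum_eq_single 0 fun k hk => by rw [h k hk, smul_zero]]
    simp
  rw [key x, key y]

/-- The Fourier transform turns the eigenvalue equation into multiplication by the character sum.
Where that sum is smaller than `|μ|` the transform of `v` must vanish, so only frequency `0`
survives. -/
theorem eq_const_of_eigenvector {S : Finset (ZMod N)} {B μ : ℝ} (hμ : B < |μ|)
    (hS : ∀ k : ZMod N, k ≠ 0 → ‖∑ s ∈ S, stdAddChar (s * k)‖ ≤ B) {v : ZMod N → ℝ}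
    (hv : ∀ x, ∑ s ∈ S, v (x + s) = μ * v x) (x y : ZMod N) : v x = v y := by
  suffices h : ((v x : ℝ) : ℂ) = v y by exact_mod_cast h
  refine eq_const_of_dft_eq_zero (Φ := fun x => (v x : ℂ)) (fun k hk => ?_) x y
  have h1 := dft_sum_translate S (fun x => (v x : ℂ)) k
  have h2 : (fun x => ∑ s ∈ S, ((v (x + s) : ℝ) : ℂ)) = fun x => (μ : ℂ) * v x := by
    funext x
    exact_mod_cast hv x
  rw [h2, dft_const_mul] at h1
  by_contra h0
  have h3 := congrArg norm (mul_right_cancel₀ h0 h1)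
  rw [Complex.norm_real, Real.norm_eq_abs] at h3
  linarith [hS k hk]

end Fourier

/-- The Cayley graph of `ℤ/n` with the connection set `S`. -/
def cayleyGraph {n : ℕ} [NeZero n] (S : Finset (Fin n)) (h0 : 0 ∉ S) (hneg : ∀ s ∈ S, -s ∈ S) :
    SimpleGraph (Fin n) where
  Adj x y := y - x ∈ S
  symm := ⟨fun x y h => by simpa using hneg _ h⟩
  loopless := ⟨fun x h => h0 (by simpa using h)⟩

instance {n : ℕ} [NeZero n] (S : Finset (Fin n)) (h0 : 0 ∉ S) (hneg : ∀ s ∈ S, -s ∈ S) :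
    DecidableRel (cayleyGraph S h0 hneg).Adj := fun x y => inferInstanceAs (Decidable (y - x ∈ S))

section Cayley

variable {n : ℕ} [NeZero n] {S : Finset (Fin n)} {h0 : 0 ∉ S} {hneg : ∀ s ∈ S, -s ∈ S}

theorem adjMatrix_cayleyGraph : (cayleyGraph S h0 hneg).adjMatrix ℝ = circ S := by
  ext x y
  rw [SimpleGraph.adjMatrix_apply, circ, Matrix.transpose_apply, Matrix.circulant_apply]
  exact if_congr Iff.rfl rfl rfl

theorem isRegularOfDegree_cayleyGraph : (cayleyGraph S h0 hneg).IsRegularOfDegree #S := by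
  intro x
  rw [← SimpleGraph.card_neighborFinset_eq_degree]
  have h : ∀ y, y ∈ (cayleyGraph S h0 hneg).neighborFinset x ↔ y - x ∈ S := fun y => by
    rw [SimpleGraph.mem_neighborFinset]
    rfl
  exact card_bij' (fun y _ => y - x) (fun s _ => s + x) (fun y hy => (h y).1 hy)
    (fun s hs => (h _).2 (by simpa using hs)) (by simp) (by simp)

theorem circ_mulVec (S : Finset (Fin n)) (v : Fin n → ℝ) (x : Fin n) :
    ((circ S).mulVec v) x = ∑ s ∈ S, v (x + s) := by
  simp only [Matrix.mulVec, dotProduct, circ, Matrix.transpose_apply, Matrix.circulant_apply,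
    ite_mul, one_mul, zero_mul]
  rw [← Equiv.sum_comp (Equiv.addLeft x)]
  simp [sum_ite_mem]

theorem exists_orthogonal_eigenvectors {ι : Type*} [Fintype ι] [DecidableEq ι] {A : Matrix ι ι ℝ}
    (hA : A.IsHermitian) : ∃ w : ι → ι → ℝ, (∀ i, A.mulVec (w i) = hA.eigenvalues i • w i) ∧
      (∀ i, w i ≠ 0) ∧ ∀ i j, i ≠ j → ∑ x, w i x * w j x = 0 := by
  refine ⟨fun i => hA.eigenvectorBasis i, hA.mulVec_eigenvectorBasis, fun i h => ?_,
    fun i j hij => ?_⟩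
  · refine hA.eigenvectorBasis.toBasis.ne_zero i ?_
    rw [OrthonormalBasis.coe_toBasis]
    ext x
    exact congrFun h x
  · have : inner ℝ (hA.eigenvectorBasis i) (hA.eigenvectorBasis j) = 0 :=
      hA.eigenvectorBasis.orthonormal.2 hij
    rw [PiLp.inner_apply] at this
    simpa [mul_comm] using this

theorem lam_le_of_eigenvalues {V : Type*} [Fintype V] [DecidableEq V] {G : SimpleGraph V}
    [DecidableRel G.Adj] {B : ℝ} (hV : 1 < Fintype.card V)
    (h : ∀ i j, i ≠ j → (G.isHermitian_adjMatrix ℝ).eigenvalues i ≤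
      (G.isHermitian_adjMatrix ℝ).eigenvalues j →
      |(G.isHermitian_adjMatrix ℝ).eigenvalues i| ≤ B) : lam G ≤ B := by
  let e : V ≃ Fin (Fintype.card V) := (Fintype.equivOfCardEq (Fintype.card_fin _)).symm
  -- `eigenvalues` is by definition `eigenvalues₀` read through this equivalence, so the index `z`
  -- with `e z = 0` carries the largest eigenvalue.
  have he : ∀ i, (G.isHermitian_adjMatrix ℝ).eigenvalues i =
    (G.isHermitian_adjMatrix ℝ).eigenvalues₀ (e i) := fun _ => rfl
  have : Nonempty {i : Fin (Fintype.card V) // 0 < (i : ℕ)} := ⟨⟨⟨1, hV⟩, one_pos⟩⟩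
  refine ciSup_le fun ⟨i, hi⟩ => ?_
  obtain ⟨i, rfl⟩ := e.surjective i
  refine h i (e.symm ⟨0, by omega⟩) (fun hz => ?_) ?_
  · rw [hz, e.apply_symm_apply] at hi
    exact absurd hi (lt_irrefl _)
  · rw [he, he, e.apply_symm_apply]
    exact (G.isHermitian_adjMatrix ℝ).eigenvalues₀_antitone (Nat.zero_le _)

/-- If a non-leading eigenvalue exceeded `B` in absolute value, its eigenvector would be constant
and the eigenvalue would equal `#S ≥ 0`. The leading eigenvalue is at least as large, so its
eigenvector would be constant too, and two nonzero constant vectors are not orthogonal. -/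
theorem lam_le {n : ℕ} (S : Finset (Fin (n + 2))) (G : SimpleGraph (Fin (n + 2)))
    [DecidableRel G.Adj] (hG : G.adjMatrix ℝ = circ S) {B : ℝ}
    (hS : ∀ k : ZMod (n + 2), k ≠ 0 →
      ‖∑ s ∈ S, stdAddChar (((s : ℕ) : ZMod (n + 2)) * k)‖ ≤ B) :
    lam G ≤ B := by
  refine lam_le_of_eigenvalues (by simp) fun i z hzi h2 => not_lt.1 fun hlt => ?_
  obtain ⟨w, hw, hw0, horth⟩ := exists_orthogonal_eigenvectors (G.isHermitian_adjMatrix ℝ)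
  generalize (G.isHermitian_adjMatrix ℝ).eigenvalues = ev at *
  have hv : ∀ i x, ∑ s ∈ S, w i (x + s) = ev i * w i x := fun i x => by
    rw [← circ_mulVec, ← hG, hw]
    rfl
  -- `ZMod (n + 2)` unfolds to `Fin (n + 2)`, so the same set serves both sides.
  let T : Finset (ZMod (n + 2)) := S
  have hT : ∀ k : ZMod (n + 2), k ≠ 0 → ‖∑ s ∈ T, stdAddChar (s * k)‖ ≤ B := fun k hk => by
    refine le_of_eq_of_le (congrArg norm (sum_congr rfl fun s _ => ?_)) (hS k hk)
    exact congrArg (fun a : ZMod (n + 2) => stdAddChar (a * k)) (ZMod.natCast_zmod_val s).symm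
  have hconst : ∀ i, B < |ev i| → ∀ x y, w i x = w i y := fun i hi =>
    eq_const_of_eigenvector (N := n + 2) hi hT (hv i)
  have hne : ∀ i, (∀ x y, w i x = w i y) → w i 0 ≠ 0 := fun i hi h =>
    hw0 i (funext fun x => (hi x 0).trans h)
  have hcard : ∀ i, B < |ev i| → ev i = #S := fun i hi => by
    have h1 := hv i 0
    rw [sum_congr rfl fun s _ => hconst i hi (0 + s) 0, sum_const, nsmul_eq_mul] at h1
    exact (mul_right_cancel₀ (hne i (hconst i hi)) h1).symm
  have h3 : B < |ev z| := by
    have h1 := hcard i hlt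
    rw [h1, abs_of_nonneg (Nat.cast_nonneg _)] at hlt
    exact hlt.trans_le ((h1 ▸ h2).trans (le_abs_self _))
  have h4 := horth z i hzi.symm
  rw [sum_congr rfl fun x _ => by rw [hconst z h3 x 0, hconst i hlt x 0], sum_const,
    nsmul_eq_mul] at h4
  have h5 : ((#(univ : Finset (Fin (n + 2))) : ℕ) : ℝ) ≠ 0 := by
    rw [card_univ, Fintype.card_fin]
    positivity
  exact mul_ne_zero h5 (mul_ne_zero (hne z (hconst z h3)) (hne i (hconst i hlt))) h4

end Cayley

end CirculantExpander

/-! ## The sample -/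

namespace CirculantExpander

theorem bit_lt_two (S v : ℕ) : bit S v < 2 := Nat.mod_lt _ two_pos

theorem bit_add_two_pow {S v : ℕ} (h : bit S v = 0) (u : ℕ) :
    bit (S + 2 ^ v) u = if u = v then 1 else bit S u := by
  unfold bit at *
  rcases lt_trichotomy u v with huv | rfl | huv
  · rw [if_neg huv.ne]
    obtain ⟨k, rfl⟩ := Nat.exists_eq_add_of_lt huv
    rw [show u + k + 1 = (k + 1) + u by ring, pow_add 2 (k + 1) u,
      Nat.add_mul_div_right _ _ (by positivity), pow_succ, Nat.add_mul_mod_self_right]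
  · rw [if_pos rfl, Nat.add_div_right _ (by positivity)]
    omega
  · rw [if_neg huv.ne']
    obtain ⟨k, rfl⟩ := Nat.exists_eq_add_of_lt huv
    have e : 2 ^ (v + k + 1) = 2 ^ v * (2 * 2 ^ k) := by ring
    rw [e, ← Nat.div_div_eq_div_mul, ← Nat.div_div_eq_div_mul, ← Nat.div_div_eq_div_mul,
      ← Nat.div_div_eq_div_mul, Nat.add_div_right _ (by positivity)]
    congr 2
    omega

/-- The subset of `{0, …, R - 1}` with the characteristic bits `S`. -/
def bitSet (R S : ℕ) : Finset ℕ := {v ∈ range R | bit S v = 1}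

theorem bitSet_zero (R : ℕ) : bitSet R 0 = ∅ := by
  simp [bitSet, bit]

theorem bitSet_add_two_pow {R S v : ℕ} (hv : v < R) (h : bit S v = 0) :
    bitSet R (S + 2 ^ v) = insert v (bitSet R S) := by
  ext u
  simp only [bitSet, mem_filter, mem_range, mem_insert, bit_add_two_pow h]
  split_ifs with huv <;> simp [huv, hv]

section Greedy

variable {ι : Type*} {T : Finset ι} {w : ι → ℕ → ℕ} {R M D : ℕ}

/-- Averaging: summed over all `v < R`, the new potentials weighted by `w τ v` total `M R` times the
old one. Excluding `0` and `A` leaves at least `R - #A - 1` candidates, so some candidate multiplies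
the potential by at most `M R / (R - #A - 1) ≤ (1 + 1 / D ^ 2) M`. -/
theorem exists_low_potential (hD : 0 < D) (hw : ∀ τ ∈ T, ∑ v ∈ range R, w τ v = M * R) {A : Finset ℕ}
    (hA : (#A + 1) * (D * D + 1) ≤ R) :
    ∃ v < R, 0 < v ∧ v ∉ A ∧ D * D * ∑ τ ∈ T, ∏ x ∈ insert v A, w τ x ≤
      (D * D + 1) * M * ∑ τ ∈ T, ∏ x ∈ A, w τ x := by
  by_contra! hcon
  set Φ := ∑ τ ∈ T, ∏ x ∈ A, w τ x with hΦ
  set U := range R \ insert 0 A with hU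
  have hcardU : R ≤ #U + (#A + 1) := by
    have h1 := le_card_sdiff (insert 0 A) (range R)
    have h2 := card_insert_le 0 A
    rw [card_range, ← hU] at h1
    omega
  have hpos : 0 < #U := by nlinarith [Nat.mul_pos hD hD]
  have hlt : ∑ v ∈ U, (D * D + 1) * M * Φ <
      ∑ v ∈ U, D * D * ∑ τ ∈ T, w τ v * ∏ x ∈ A, w τ x := by
    refine sum_lt_sum_of_nonempty (card_pos.1 hpos) fun v hv => ?_
    simp only [hU, mem_sdiff, mem_range, mem_insert, not_or] at hv
    have := hcon v hv.1 (Nat.pos_of_ne_zero hv.2.1) hv.2.2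
    simpa only [prod_insert hv.2.2] using this
  have hle : ∑ v ∈ U, D * D * ∑ τ ∈ T, w τ v * ∏ x ∈ A, w τ x ≤ D * D * (M * R * Φ) := by
    rw [← mul_sum]
    refine Nat.mul_le_mul_left _ ((sum_le_sum_of_subset sdiff_subset).trans_eq ?_)
    rw [sum_comm, hΦ, mul_sum]
    exact sum_congr rfl fun τ hτ => by rw [← sum_mul, hw τ hτ]
  rw [sum_const, smul_eq_mul] at hlt
  have h3 := hlt.trans_le hle
  have h4 : #U * (D * D + 1) * (M * Φ) < D * D * R * (M * Φ) := by
    calc _ = #U * ((D * D + 1) * M * Φ) := by ring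
      _ < _ := h3
      _ = _ := by ring
  have h5 := lt_of_mul_lt_mul_right h4 (Nat.zero_le _)
  nlinarith

end Greedy

theorem arcInd_le_one {N j u e v : ℕ} (he : e < 2) : arcInd N j u e v ≤ 1 := by
  unfold arcInd
  split_ifs <;> omega

theorem sum_arcInd_le {R N j u e : ℕ} (he : e < 2) : ∑ w ∈ range R, arcInd N j u e w ≤ R :=
  (sum_le_card_nsmul _ _ 1 fun _ _ => arcInd_le_one he).trans (by simp)

theorem cast_arcWeight {D R N j u e : ℕ} (hD : 0 < D) (he : e < 2) (v : ℕ) :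
    (arcWeight D R N j u e v : ℤ) =
      D * R + R * arcInd N j u e v - ∑ w ∈ range R, (arcInd N j u e w : ℤ) := by
  have h := (sum_arcInd_le (R := R) (N := N) (j := j) (u := u) he).trans
    (Nat.le_mul_of_pos_left R hD)
  rw [arcWeight, Nat.cast_sub (h.trans (Nat.le_add_right _ _))]
  push_cast
  ring

theorem sum_arcWeight {D R N j u e : ℕ} (hD : 0 < D) (he : e < 2) :
    ∑ v ∈ range R, arcWeight D R N j u e v = D * R * R := by
  zify
  simp only [cast_arcWeight hD he, sum_sub_distrib, sum_add_distrib, sum_const, card_range,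
    nsmul_eq_mul, ← mul_sum]
  ring

theorem potential_eq (D R N S : ℕ) : potential D R N S =
    ∑ τ ∈ range N ×ˢ range (N + 1) ×ˢ range 2,
      ∏ v ∈ bitSet R S, arcWeight D R N τ.1 τ.2.1 τ.2.2 v := by
  simp only [potential, sum_product, bitSet, prod_filter]

/-- The indices counted by `pick` are exactly those below the least improving `v`. -/
theorem pick_spec {D R N S : ℕ} (h : ∃ v < R, Improves D R N S v) :
    pick D R N S < R ∧ Improves D R N S (pick D R N S) := by
  classical
  have hf := Nat.find_spec h
  have key : pick D R N S = Nat.find h := by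
    rw [pick, ← card_filter, ← card_range (Nat.find h)]
    congr 1
    ext i
    simp only [mem_filter, mem_range]
    constructor
    · rintro ⟨-, hi⟩
      by_contra hlt
      exact hi _ (by omega) hf.2
    · exact fun hi => ⟨hi.trans hf.1, fun v hv hI =>
        Nat.find_min h (lt_of_le_of_lt (Nat.lt_succ_iff.1 hv) hi) ⟨by omega, hI⟩⟩
  rw [key]
  exact hf

/-- The sample after `i` greedy steps. -/
def sample (D R N i : ℕ) : Finset ℕ := bitSet R (sampleCode D R N i)

/-- Each step multiplies the potential by at most `(1 + 1 / D ^ 2) D R`, stated with denominators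
cleared. The empty sample has potential equal to the number of tests, `N * ((N + 1) * 2)`. -/
theorem sample_spec {D R N : ℕ} (hD : 0 < D) (i : ℕ) (hi : i * (D * D + 1) ≤ R) :
    #(sample D R N i) = i ∧ 0 ∉ sample D R N i ∧
      (D * D) ^ i * potential D R N (sampleCode D R N i) ≤
        ((D * D + 1) * (D * R)) ^ i * (N * ((N + 1) * 2)) := by
  induction i with
  | zero => simp [sample, sampleCode, bitSet_zero, potential_eq, card_product]
  | succ i ih =>
    obtain ⟨h1, h2, h3⟩ := ih (le_trans (Nat.mul_le_mul_right _ (Nat.le_succ i)) hi)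
    set S := sampleCode D R N i with hS
    have hex : ∃ v < R, Improves D R N S v := by
      obtain ⟨v, hvR, hv0, hvA, hv⟩ := exists_low_potential (R := R) (M := D * R) (D := D)
        (T := range N ×ˢ range (N + 1) ×ˢ range 2) (A := bitSet R S)
        (w := fun τ => arcWeight D R N τ.1 τ.2.1 τ.2.2) hD
        (fun τ hτ => sum_arcWeight hD (by simp only [mem_product, mem_range] at hτ; exact hτ.2.2))
        (by rw [show #(bitSet R S) = i from h1]; exact hi)
      have hb : bit S v = 0 := by
        have : bit S v ≠ 1 := fun h => hvA (mem_filter.2 ⟨mem_range.2 hvR, h⟩)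
        have := bit_lt_two S v
        omega
      refine ⟨v, hvR, ⟨hv0, hb⟩, ?_⟩
      rw [potential_eq, potential_eq, bitSet_add_two_pow hvR hb]
      exact hv
    obtain ⟨hlt, ⟨hpos, hbit⟩, hle⟩ := pick_spec hex
    have hnotin : pick D R N S ∉ bitSet R S := fun h => by
      rw [(mem_filter.1 h).2] at hbit
      exact one_ne_zero hbit
    have hins : sample D R N (i + 1) = insert (pick D R N S) (bitSet R S) :=
      bitSet_add_two_pow hlt hbit
    refine ⟨?_, ?_, ?_⟩
    · rw [hins, card_insert_of_notMem hnotin]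
      exact congrArg (· + 1) h1
    · rw [hins, mem_insert, not_or]
      exact ⟨hpos.ne, h2⟩
    · calc (D * D) ^ (i + 1) * potential D R N (sampleCode D R N (i + 1))
          = (D * D) ^ i * (D * D * potential D R N (S + 2 ^ pick D R N S)) := by
            rw [sampleCode, pow_succ, mul_assoc]
        _ ≤ (D * D) ^ i * ((D * D + 1) * (D * R) * potential D R N S) := by gcongr
        _ = (D * D + 1) * (D * R) * ((D * D) ^ i * potential D R N S) := by ring
        _ ≤ (D * D + 1) * (D * R) * (((D * D + 1) * (D * R)) ^ i * (N * ((N + 1) * 2))) := by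
            gcongr
        _ = _ := by ring

theorem sub_sq_le_log_one_add {x : ℝ} (h : |x| ≤ 1 / 2) : x - x ^ 2 ≤ Real.log (1 + x) := by
  obtain ⟨h1, h2⟩ := abs_le.1 h
  rw [Real.le_log_iff_exp_le (by linarith)]
  rcases le_total 0 x with hx | hx
  · have h3 := (abs_le.1 (Real.abs_exp_sub_one_sub_id_le (x := x - x ^ 2)
      (abs_le.2 ⟨by nlinarith, by nlinarith⟩))).2
    nlinarith [mul_nonneg (pow_nonneg hx 3) (by linarith : 0 ≤ 2 - x)]
  -- With `z = x ^ 2 - x ≥ 0` it is enough that `(1 + z + z ^ 2 / 2) (1 + x) ≥ 1`; the difference is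
  -- `x ^ 2 / 2` times the expression in `h4`.
  · have h3 := Real.quadratic_le_exp_of_nonneg (x := -(x - x ^ 2)) (by nlinarith)
    rw [← inv_inv (Real.exp (x - x ^ 2)), ← Real.exp_neg]
    rw [inv_le_comm₀ (Real.exp_pos _) (by linarith), inv_eq_one_div, div_le_iff₀ (by linarith)]
    refine le_trans ?_ (mul_le_mul_of_nonneg_right h3 (by linarith : 0 ≤ 1 + x))
    have h4 : 0 ≤ (1 - x) ^ 2 * (1 + x) + 2 * x := by nlinarith
    nlinarith [mul_nonneg (sq_nonneg x) h4]

theorem prod_arcWeight_le_potential {D R N S j u e : ℕ} (hj : j < N) (hu : u ≤ N) (he : e < 2) :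
    ∏ v ∈ bitSet R S, arcWeight D R N j u e v ≤ potential D R N S := by
  have key : ∀ (T : Finset (ℕ × ℕ × ℕ)) (τ : ℕ × ℕ × ℕ), τ ∈ T →
      ∏ v ∈ bitSet R S, arcWeight D R N τ.1 τ.2.1 τ.2.2 v ≤
        ∑ τ ∈ T, ∏ v ∈ bitSet R S, arcWeight D R N τ.1 τ.2.1 τ.2.2 v := fun T τ hτ =>
    single_le_sum_of_canonicallyOrdered (f := fun τ : ℕ × ℕ × ℕ => ∏ v ∈ bitSet R S,
      arcWeight D R N τ.1 τ.2.1 τ.2.2 v) hτ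
  have hmem : (j, u, e) ∈ range N ×ˢ range (N + 1) ×ˢ range 2 :=
    mem_product.2 ⟨mem_range.2 hj, mem_product.2 ⟨mem_range.2 (Nat.lt_succ_of_le hu),
      mem_range.2 he⟩⟩
  exact (key _ _ hmem).trans_eq (potential_eq D R N S).symm

/-- Dividing a weight by its mean `D R` leaves `1 + g / D` with `g` the centred indicator. A single
product is at most the whole potential, so logarithms bound `∑ g / D` by three terms, each at most
`t / D ^ 2`: the quadratic error of the logarithm, the loss in the greedy steps, and the logarithm
of the number of tests. -/
theorem sum_arcInd_sample_le {D R N t j u e : ℕ} (hD : 2 ≤ D) (hR : t * (D * D + 1) ≤ R)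
    (hR0 : 0 < R)
    (ht : D * D * Real.log (N * ((N + 1) * 2)) ≤ t) (hj : j < N) (hu : u ≤ N) (he : e < 2) :
    ∑ v ∈ sample D R N t, ((arcInd N j u e v : ℝ) - (∑ w ∈ range R, (arcInd N j u e w : ℝ)) / R)
      ≤ 3 * t / D := by
  obtain ⟨hcard, -, hpot⟩ := sample_spec (N := N) (by omega : 0 < D) t hR
  have hD' : (2 : ℝ) ≤ D := by exact_mod_cast hD
  have hD0 : (0 : ℝ) < D := by linarith
  have hR0' : (0 : ℝ) < R := by exact_mod_cast hR0
  set q : ℝ := ∑ w ∈ range R, (arcInd N j u e w : ℝ) with hq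
  set g : ℕ → ℝ := fun v => (arcInd N j u e v : ℝ) - q / R with hg
  have hq0 : 0 ≤ q / R := by positivity
  have hq1 : q / R ≤ 1 := by
    rw [div_le_one hR0', hq]
    exact_mod_cast sum_arcInd_le he
  have hg1 : ∀ v, |g v| ≤ 1 := fun v => by
    have h1 : (arcInd N j u e v : ℝ) ≤ 1 := by exact_mod_cast arcInd_le_one he
    have h0 : (0 : ℝ) ≤ arcInd N j u e v := Nat.cast_nonneg _
    exact abs_le.2 ⟨by simp only [hg]; linarith, by simp only [hg]; linarith⟩
  have hgD : ∀ v, |g v / D| ≤ 1 / 2 := fun v => by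
    rw [abs_div, abs_of_pos hD0]
    exact div_le_div₀ zero_le_one (hg1 v) two_pos hD'
  have hw : ∀ v, (arcWeight D R N j u e v : ℝ) = D * R * (1 + g v / D) := fun v => by
    have := congrArg (Int.cast : ℤ → ℝ) (cast_arcWeight (R := R) (N := N) (j := j) (u := u)
      (by omega : 0 < D) he v)
    push_cast at this
    rw [this, hg]
    field_simp
    ring
  have hone : ∏ v ∈ sample D R N t, arcWeight D R N j u e v ≤
      potential D R N (sampleCode D R N t) := prod_arcWeight_le_potential hj hu he
  have h1 : ((D * D : ℝ)) ^ t * ∏ v ∈ sample D R N t, (D * R * (1 + g v / D)) ≤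
      ((D * D + 1) * (D * R)) ^ t * (N * ((N + 1) * 2)) := by
    simp only [← hw]
    exact_mod_cast (Nat.mul_le_mul_left _ hone).trans hpot
  rw [prod_mul_distrib, prod_const, hcard] at h1
  have hpos : ∀ v, 0 < 1 + g v / D := fun v => by linarith [(abs_le.1 (hgD v)).1]
  have h2 : ∏ v ∈ sample D R N t, (1 + g v / D) ≤
      (1 + 1 / (D * D : ℝ)) ^ t * (N * ((N + 1) * 2)) := by
    have e1 : ((D * D + 1) * (D * R) : ℝ) ^ t =
        (D * D : ℝ) ^ t * ((D * R) ^ t * (1 + 1 / (D * D : ℝ)) ^ t) := by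
      rw [← mul_pow, ← mul_pow]
      congr 1
      field_simp
    rw [e1, mul_assoc, mul_assoc] at h1
    exact le_of_mul_le_mul_left (le_of_mul_le_mul_left h1 (by positivity)) (by positivity)
  have hN : (0 : ℝ) < N := by exact_mod_cast (by omega : 0 < N)
  have h3 := Real.log_le_log (prod_pos fun v _ => hpos v) h2
  rw [Real.log_prod fun v _ => (hpos v).ne', Real.log_mul (by positivity) (by positivity),
    Real.log_pow] at h3
  have h4 : Real.log (1 + 1 / (D * D : ℝ)) ≤ 1 / (D * D) := by
    have := Real.log_le_sub_one_of_pos (by positivity : 0 < 1 + 1 / (D * D : ℝ))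
    linarith
  have h5 : ∑ v ∈ sample D R N t, (g v / D - 1 / (D * D)) ≤
      ∑ v ∈ sample D R N t, Real.log (1 + g v / D) := by
    refine sum_le_sum fun v _ => le_trans ?_ (sub_sq_le_log_one_add (hgD v))
    have : (g v / D) ^ 2 ≤ 1 / (D * D) := by
      rw [div_pow, sq (D : ℝ)]
      gcongr
      exact (sq_le_one_iff_abs_le_one _).2 (hg1 v)
    linarith
  rw [sum_sub_distrib, sum_const, hcard, nsmul_eq_mul, ← sum_div] at h5
  have h6 : Real.log (N * ((N + 1) * 2)) ≤ t / (D * D) := by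
    rw [le_div_iff₀ (by positivity)]
    linarith
  have h7 : (t : ℝ) * Real.log (1 + 1 / (D * D : ℝ)) ≤ t * (1 / (D * D)) := by gcongr
  have h8 : (∑ v ∈ sample D R N t, g v) / D ≤ 3 * t / (D * D) := by
    have : 3 * (t : ℝ) / (D * D) = t * (1 / (D * D)) + t * (1 / (D * D)) + t / (D * D) := by ring
    linarith
  rw [div_le_iff₀ hD0] at h8
  refine h8.trans_eq ?_
  field_simp

end CirculantExpander

/-! ### From arcs to exponential sums over the sample. -/

namespace CirculantExpander

open Real in
-- Multiplying by `2 sin (π β)` telescopes the sum, and Jordan's inequality gives `sin (π β) ≥ 2 β`.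
theorem abs_sum_cos_le {β : ℝ} (h0 : 0 < β) (h1 : β ≤ 1 / 2) (R : ℕ) :
    |∑ v ∈ range R, cos (2 * π * β * v)| ≤ 1 / (2 * β) := by
  have hs : 2 * β ≤ sin (π * β) := by
    have := mul_le_sin (x := π * β) (by positivity) (by nlinarith [pi_pos])
    rwa [← mul_assoc, div_mul_cancel₀ _ pi_pos.ne'] at this
  have hs0 : 0 < sin (π * β) := by linarith
  have key : 2 * sin (π * β) * ∑ v ∈ range R, cos (2 * π * β * v) =
      sin (π * β * (2 * R - 1)) + sin (π * β) := by
    induction R with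
    | zero => simp
    | succ R ih =>
      rw [sum_range_succ, mul_add, ih]
      have e1 : π * β * (2 * ((R + 1 : ℕ) : ℝ) - 1) = 2 * π * β * R + π * β := by
        push_cast; ring
      have e2 : π * β * (2 * (R : ℝ) - 1) = 2 * π * β * R - π * β := by ring
      rw [e1, e2, sin_add, sin_sub]
      ring
  have h2 : |2 * sin (π * β) * ∑ v ∈ range R, cos (2 * π * β * v)| ≤ 2 := by
    rw [key, abs_le]
    have := sin_le_one (π * β * (2 * R - 1))
    have := neg_one_le_sin (π * β * (2 * R - 1))
    have := sin_le_one (π * β)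
    constructor <;> linarith
  rw [abs_mul, abs_of_pos (by positivity)] at h2
  rw [le_div_iff₀ (by positivity)]
  nlinarith [abs_nonneg (∑ v ∈ range R, cos (2 * π * β * v))]

open Real in
-- Summation by parts: the increments of the cosine from `x` to `N` telescope to `1 - cos`, which
-- writes the cosine as a combination of arc indicators.
theorem cos_eq_sub_sum {N x : ℕ} (hN : 0 < N) (hx : x < N) :
    cos (2 * π * x / N) = 1 - ∑ u ∈ range N,
      (cos (2 * π * (u + 1 : ℕ) / N) - cos (2 * π * u / N)) * if x < u + 1 then 1 else 0 := by
  have h1 : ∑ u ∈ range N, (cos (2 * π * (u + 1 : ℕ) / N) - cos (2 * π * u / N)) *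
      (if x < u + 1 then 1 else 0) =
      ∑ u ∈ Ico x N, (cos (2 * π * (u + 1 : ℕ) / N) - cos (2 * π * u / N)) := by
    simp only [mul_ite, mul_one, mul_zero]
    rw [← sum_filter]
    congr 1
    ext u
    simp only [mem_filter, mem_range, mem_Ico]
    omega
  have hN' : (N : ℝ) ≠ 0 := by exact_mod_cast hN.ne'
  rw [h1, sum_Ico_sub (fun u : ℕ => cos (2 * π * u / N)) hx.le, mul_div_cancel_right₀ _ hN',
    cos_two_pi]
  ring

open Real in
theorem cos_mod {N : ℕ} (hN : 0 < N) (a : ℕ) :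
    cos (2 * π * a / N) = cos (2 * π * (a % N : ℕ) / N) := by
  have hN' : (N : ℝ) ≠ 0 := by exact_mod_cast hN.ne'
  conv_lhs => rw [← Nat.mod_add_div a N]
  refine Eq.trans (congrArg cos ?_) (cos_add_nat_mul_two_pi _ (a / N))
  push_cast
  field_simp

open Real in
-- The `N` increments of the cosine are at most `2 π / N` each, so passing from arcs to cosines
-- costs a factor `2 π`. The tests with `e = 0` and `e = 1` supply the two signs of the arc
-- discrepancy.
theorem abs_sum_cos_sample_sub_le {D R N t j : ℕ} (hD : 2 ≤ D) (hR : t * (D * D + 1) ≤ R)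
    (hR0 : 0 < R) (ht : D * D * log (N * ((N + 1) * 2)) ≤ t) (hj : j < N) :
    |∑ v ∈ sample D R N t, cos (2 * π * (j * v : ℕ) / N) -
      t * (∑ v ∈ range R, cos (2 * π * (j * v : ℕ) / N)) / R| ≤ 2 * π * (3 * t / D) := by
  have hN : 0 < N := by omega
  have hN' : (0 : ℝ) < N := by exact_mod_cast hN
  have hR' : (R : ℝ) ≠ 0 := by exact_mod_cast hR0.ne'
  have hcard : (#(sample D R N t) : ℝ) = t := by
    rw [(sample_spec (N := N) (by omega : 0 < D) t hR).1]
  set A := sample D R N t with hA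
  let Δ : ℕ → ℝ := fun u => cos (2 * π * (u + 1 : ℕ) / N) - cos (2 * π * u / N)
  let f : ℕ → ℕ → ℝ := fun u v => if j * v % N < u then 1 else 0
  have hcos : ∀ v : ℕ, cos (2 * π * (j * v : ℕ) / N) = 1 - ∑ u ∈ range N, Δ u * f (u + 1) v :=
    fun v => by rw [cos_mod hN, cos_eq_sub_sum hN (Nat.mod_lt _ hN)]
  have hdev : ∀ u ≤ N, |∑ v ∈ A, f u v - t * (∑ v ∈ range R, f u v) / R| ≤ 3 * t / D := by
    intro u hu
    have h0 := sum_arcInd_sample_le hD hR hR0 ht hj hu (show 0 < 2 by omega)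
    have h1 := sum_arcInd_sample_le hD hR hR0 ht hj hu (show 1 < 2 by omega)
    have e0 : ∀ v, (arcInd N j u 0 v : ℝ) = f u v := fun v => by
      simp only [arcInd, f]; split_ifs <;> simp
    have e1 : ∀ v, (arcInd N j u 1 v : ℝ) = 1 - f u v := fun v => by
      simp only [arcInd, f]; split_ifs <;> simp
    simp only [e0, e1, sum_sub_distrib, sum_const, card_range, nsmul_eq_mul, ← hA, hcard,
      mul_one] at h0 h1
    rw [sub_div, div_self hR'] at h1
    rw [abs_le, mul_div_assoc (t : ℝ) (∑ v ∈ range R, f u v)]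
    constructor <;> linarith
  have hΔ : ∀ u, |Δ u| ≤ 2 * π / N := fun u => by
    refine (abs_cos_sub_cos_le _ _).trans_eq ?_
    rw [show 2 * π * (u + 1 : ℕ) / N - 2 * π * u / N = 2 * π / N by push_cast; field_simp; ring]
    exact abs_of_nonneg (by positivity)
  have key : ∑ v ∈ A, cos (2 * π * (j * v : ℕ) / N) -
      t * (∑ v ∈ range R, cos (2 * π * (j * v : ℕ) / N)) / R =
      -∑ u ∈ range N, Δ u * (∑ v ∈ A, f (u + 1) v - t * (∑ v ∈ range R, f (u + 1) v) / R) := by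
    simp only [hcos, sum_sub_distrib, sum_const, card_range, nsmul_eq_mul, hcard, mul_one, mul_sub]
    rw [sum_comm (s := A), sum_comm (s := range R)]
    simp only [← mul_sum]
    have : ∑ u ∈ range N, Δ u * (t * (∑ v ∈ range R, f (u + 1) v) / R) =
        t * (∑ u ∈ range N, Δ u * ∑ v ∈ range R, f (u + 1) v) / R := by
      rw [mul_sum, sum_div]
      exact sum_congr rfl fun u _ => by ring
    rw [this]
    field_simp
    ring
  rw [key, abs_neg]
  refine (abs_sum_le_sum_abs _ _).trans ?_
  calc _ ≤ ∑ u ∈ range N, 2 * π / N * (3 * t / D) := by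
        refine sum_le_sum fun u hu => ?_
        rw [abs_mul]
        exact mul_le_mul (hΔ u) (hdev _ (mem_range.1 hu)) (abs_nonneg _) (by positivity)
    _ = _ := by
        rw [sum_const, card_range, nsmul_eq_mul]
        field_simp

open Real in
/-- The exponential sums over the sample are small at all frequencies away from `0`. -/
theorem abs_sum_cos_sample_le {D R t : ℕ} (hD : 2 ≤ D) (hR : t * (D * D + 1) ≤ R)
    (hR0 : 0 < R) (ht : D * D * log ((D * R : ℕ) * (((D * R : ℕ) + 1) * 2)) ≤ t) {β : ℝ}
    (hβ : D / R ≤ β) (hβ1 : β ≤ 1 / 2) :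
    |∑ v ∈ sample D R (D * R) t, cos (2 * π * β * v)| ≤ 33 * t / D := by
  have hD' : (2 : ℝ) ≤ D := by exact_mod_cast hD
  have hR' : (0 : ℝ) < R := by exact_mod_cast hR0
  have hD0 : (0 : ℝ) < D := by linarith
  have hβ0 : 0 < β := lt_of_lt_of_le (by positivity) hβ
  have hcard : (#(sample D R (D * R) t) : ℝ) = t := by
    rw [(sample_spec (N := D * R) (by omega : 0 < D) t hR).1]
  have hsub : ∀ v ∈ sample D R (D * R) t, v < R := fun v hv => mem_range.1 (mem_filter.1 hv).1
  have hNpos : (0 : ℝ) < (D * R : ℕ) := by push_cast; positivity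
  -- The frequency is rounded down to `j / N` with `N = D R`. The error is below `1 / N`, so for `v
  -- < R` the cosine moves by at most `2 π / D`.
  set j := ⌊β * (D * R : ℕ)⌋₊ with hj
  have hj1 : (j : ℝ) ≤ β * (D * R : ℕ) := Nat.floor_le (by positivity)
  have hj2 : β * (D * R : ℕ) < j + 1 := Nat.lt_floor_add_one _
  have hjN : j < D * R := by
    have : (j : ℝ) < (D * R : ℕ) := by nlinarith
    exact_mod_cast this
  have hcos : ∀ v < R, |cos (2 * π * β * v) - cos (2 * π * (j * v : ℕ) / (D * R : ℕ))| ≤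
      2 * π / D := fun v hv => by
    refine (abs_cos_sub_cos_le _ _).trans ?_
    have hv' : (v : ℝ) ≤ R := by exact_mod_cast hv.le
    have e : 2 * π * β * v - 2 * π * (j * v : ℕ) / (D * R : ℕ) =
        2 * π * v * ((β * (D * R : ℕ) - j) / (D * R : ℕ)) := by
      push_cast
      field_simp
    have hnn : 0 ≤ (β * (D * R : ℕ) - j) / (D * R : ℕ) := div_nonneg (by linarith) hNpos.le
    rw [e, abs_of_nonneg (by positivity)]
    calc 2 * π * v * ((β * (D * R : ℕ) - j) / (D * R : ℕ)) ≤ 2 * π * R * (1 / (D * R : ℕ)) := by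
          gcongr
          linarith
      _ = 2 * π / D := by push_cast; field_simp
  have h1 := abs_sum_cos_sample_sub_le hD hR hR0 ht hjN
  have h2 := abs_sum_cos_le hβ0 hβ1 R
  have h3 : |∑ v ∈ sample D R (D * R) t, cos (2 * π * β * v) -
      ∑ v ∈ sample D R (D * R) t, cos (2 * π * (j * v : ℕ) / (D * R : ℕ))| ≤ t * (2 * π / D) := by
    rw [← sum_sub_distrib, ← hcard, ← nsmul_eq_mul]
    exact (abs_sum_le_sum_abs _ _).trans (sum_le_card_nsmul _ _ _ fun v hv => hcos v (hsub v hv))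
  have h4 : |∑ v ∈ range R, cos (2 * π * β * v) -
      ∑ v ∈ range R, cos (2 * π * (j * v : ℕ) / (D * R : ℕ))| ≤ R * (2 * π / D) := by
    have hc : (R : ℝ) = #(range R) := by rw [card_range]
    rw [← sum_sub_distrib, hc, ← nsmul_eq_mul]
    exact (abs_sum_le_sum_abs _ _).trans
      (sum_le_card_nsmul _ _ _ fun v hv => hcos v (mem_range.1 hv))
  have h5 : 1 / (2 * β) ≤ R / (2 * D) := by
    rw [div_le_div_iff₀ (by positivity) (by positivity)]
    rw [div_le_iff₀ hR'] at hβ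
    linarith
  set a := ∑ v ∈ sample D R (D * R) t, cos (2 * π * β * v)
  set b := ∑ v ∈ sample D R (D * R) t, cos (2 * π * (j * v : ℕ) / (D * R : ℕ))
  set c := ∑ v ∈ range R, cos (2 * π * (j * v : ℕ) / (D * R : ℕ))
  have h6 : |c| ≤ R * (2 * π / D + 1 / (2 * D)) := by
    have : R * (2 * π / D + 1 / (2 * D)) = R * (2 * π / D) + R / (2 * D) := by ring
    rw [this]
    have := abs_sub_abs_le_abs_sub c (∑ v ∈ range R, cos (2 * π * β * v))
    rw [abs_sub_comm] at this
    linarith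
  have h7 : |t * c / R| ≤ t * (2 * π / D + 1 / (2 * D)) := by
    rw [abs_div, abs_mul, Nat.abs_cast, Nat.abs_cast, div_le_iff₀ hR']
    calc t * |c| ≤ t * (R * (2 * π / D + 1 / (2 * D))) := by gcongr
      _ = _ := by ring
  -- Rounding on the sample, discrepancy, and the mean over the full interval (itself rounded) add
  -- up to `(10 π + 1 / 2) t / D`.
  have h8 : |a| ≤ t * (2 * π / D) + 2 * π * (3 * t / D) + t * (2 * π / D + 1 / (2 * D)) := by
    have e : a = (a - b) + (b - t * c / R) + t * c / R := by ring
    rw [e]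
    refine (abs_add_three _ _ _).trans ?_
    gcongr
  refine h8.trans ?_
  have e : t * (2 * π / D) + 2 * π * (3 * t / D) + t * (2 * π / D + 1 / (2 * D)) =
      (10 * π + 1 / 2) * t / D := by field_simp; ring
  rw [e]
  gcongr
  linarith [pi_lt_d2]

end CirculantExpander

/-! ## The selected primes -/

namespace CirculantExpander

theorem usable_iff {n c : ℕ} (hc : 2 ≤ c) : Usable n c ↔ c.Prime ∧ ¬ c ∣ n := by
  refine and_congr ⟨fun h => ?_, fun h i hi hd => ?_⟩ (not_congr (Nat.dvd_iff_mod_eq_zero).symm)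
  · refine Nat.prime_def_lt.2 ⟨hc, fun i hi hd => ?_⟩
    have h1 := h i hi
    have h2 : c % i = 0 := Nat.mod_eq_zero_of_dvd hd
    have h3 : i ≠ 0 := by
      rintro rfl
      have := Nat.eq_zero_of_zero_dvd hd
      omega
    omega
  · have := (Nat.prime_def_lt.1 h).2 i hi (Nat.dvd_of_mod_eq_zero hd.2)
    omega

/-- An element satisfying `Q` is kept exactly while fewer than `m` predecessors satisfy it. -/
theorem card_filter_first (Q : ℕ → Prop) [DecidablePred Q] (m M : ℕ) :
    #{c ∈ range M | Q c ∧ (∑ i ∈ range c, if Q i then 1 else 0) < m} =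
      min m (∑ i ∈ range M, if Q i then 1 else 0) := by
  induction M with
  | zero => simp
  | succ M ih =>
    rw [range_add_one, filter_insert, sum_insert notMem_range_self]
    by_cases h : Q M
    · by_cases h2 : (∑ i ∈ range M, if Q i then 1 else 0) < m
      · rw [if_pos ⟨h, h2⟩, card_insert_of_notMem (by simp), ih, if_pos h]
        omega
      · rw [if_neg (by tauto), ih, if_pos h]
        omega
    · rw [if_neg (by tauto), ih, if_neg h, zero_add]

/-- Distinct primes dividing `F` have their product dividing `F`, and that product is at least `2 ^
(r * #P)`. -/
theorem mul_card_le_of_prime_dvd {P : Finset ℕ} {F r s : ℕ} (hP : ∀ p ∈ P, p.Prime ∧ 2 ^ r ≤ p)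
    (hF : F ≠ 0) (hdvd : ∀ p ∈ P, p ∣ F) (hs : F ≤ 2 ^ s) : r * #P ≤ s := by
  have h1 : (2 ^ r) ^ #P ≤ ∏ p ∈ P, p := by
    rw [← prod_const]
    exact prod_le_prod' fun p hp => (hP p hp).2
  have h2 : ∏ p ∈ P, p ≤ F := Nat.le_of_dvd (Nat.pos_of_ne_zero hF)
    (prod_primes_dvd F (fun p hp => (hP p hp).1.prime) hdvd)
  rw [← pow_mul] at h1
  exact (Nat.pow_le_pow_iff_right one_lt_two).1 (h1.trans (h2.trans hs))

open Chebyshev in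
-- Compare `θ(4 R) - θ(R)` with the number of primes times `log (4 R)`. The endpoint `4 R` lets the
-- lower bound `4 R log 2` beat the upper bound `R log 4`.
theorem le_card_primes_mul_log (R : ℕ) (hR : 1 ≤ R) :
    2 * R * Real.log 2 - Real.log (4 * R + 1) - 4 * √R * Real.log (4 * R) ≤
      #{p ∈ Ioc R (4 * R) | p.Prime} * Real.log (4 * R) := by
  have h1 := theta_ge (4 * R)
  have h2 := theta_le_log4_mul_x (x := R) (Nat.cast_nonneg R)
  have h3 : θ (4 * R : ℕ) - θ R ≤ #{p ∈ Ioc R (4 * R) | p.Prime} * Real.log (4 * R) := by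
    have e : θ (4 * R : ℕ) - θ R = ∑ p ∈ Ioc R (4 * R) with p.Prime, Real.log p := by
      rw [theta, theta, Nat.floor_natCast, Nat.floor_natCast, sub_eq_iff_eq_add']
      rw [← sum_union]
      · refine sum_congr ?_ fun _ _ => rfl
        ext p
        simp only [mem_filter, mem_Ioc, mem_union]
        by_cases hp : p.Prime <;> simp only [hp, and_true, and_false, or_self]
        omega
      · rw [disjoint_left]
        intro p hp hp'
        simp only [mem_filter, mem_Ioc] at hp hp'
        omega
    rw [e, ← nsmul_eq_mul]
    refine sum_le_card_nsmul _ _ _ fun p hp => ?_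
    simp only [mem_filter, mem_Ioc] at hp
    refine Real.log_le_log (by exact_mod_cast hp.2.pos) ?_
    exact_mod_cast hp.1.2
  have h4 : Real.log 4 = 2 * Real.log 2 := by
    rw [show (4 : ℝ) = 2 ^ 2 by norm_num, Real.log_pow]
    norm_num
  have h5 : √((4 * R : ℕ) : ℝ) = 2 * √R := by
    push_cast
    rw [Real.sqrt_mul (by norm_num), show (4 : ℝ) = 2 ^ 2 by norm_num,
      Real.sqrt_sq (by norm_num)]
  rw [h5] at h1
  rw [h4] at h2
  push_cast at h1 h3
  linarith

theorem rangeLen_eq (b : ℕ) : rangeLen b = 2 ^ (4 * b) := by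
  rw [rangeLen]
  ring

theorem le_card_primes_rangeLen (b : ℕ) (hb : 2 ^ (2 * b) * (20 * b + 20) ≤ 2 ^ (4 * b)) :
    2 ^ (2 * b) ≤ #{p ∈ Ioc (rangeLen b) (4 * rangeLen b) | p.Prime} := by
  have h := le_card_primes_mul_log (rangeLen b) (by rw [rangeLen_eq]; exact Nat.one_le_two_pow)
  set cnt := #{p ∈ Ioc (rangeLen b) (4 * rangeLen b) | p.Prime}
  have hlog2 : 0 < Real.log 2 := Real.log_pos one_lt_two
  have e1 : (rangeLen b : ℝ) = 2 ^ (4 * b) := by rw [rangeLen_eq]; push_cast; rfl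
  have e2 : √(rangeLen b : ℝ) = 2 ^ (2 * b) := by
    rw [e1, show 4 * b = 2 * b * 2 by ring, pow_mul _ (2 * b)]
    exact Real.sqrt_sq (by positivity)
  have e3 : Real.log (4 * rangeLen b) = (4 * b + 2) * Real.log 2 := by
    rw [e1, show (4 : ℝ) * 2 ^ (4 * b) = 2 ^ (4 * b + 2) by ring, Real.log_pow]
    push_cast
    ring
  have e4 : Real.log (4 * rangeLen b + 1) ≤ (4 * b + 3) * Real.log 2 := by
    have : (4 : ℝ) * rangeLen b + 1 ≤ 2 ^ (4 * b + 3) := by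
      rw [e1]
      have : (1 : ℝ) ≤ 2 ^ (4 * b) := one_le_pow₀ one_le_two
      have e : (2 : ℝ) ^ (4 * b + 3) = 8 * 2 ^ (4 * b) := by ring
      linarith
    refine (Real.log_le_log (by positivity) this).trans_eq ?_
    rw [Real.log_pow]
    push_cast
    ring
  rw [e2, e3] at h
  rw [e1] at h e4
  have h2 : (2 * 2 ^ (4 * b) - (4 * b + 3) - 4 * 2 ^ (2 * b) * (4 * b + 2) : ℝ) ≤
      cnt * (4 * b + 2) := by
    refine le_of_mul_le_mul_right ?_ hlog2
    linarith
  have h3 : (2 : ℝ) ^ (2 * b) * (20 * b + 20) ≤ 2 ^ (4 * b) := by exact_mod_cast hb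
  have h4 : (1 : ℝ) ≤ 2 ^ (2 * b) := one_le_pow₀ one_le_two
  have hb0 : (0 : ℝ) ≤ b := Nat.cast_nonneg b
  have h5 : ((2 : ℝ) ^ (2 * b)) * (4 * b + 2) ≤ cnt * (4 * b + 2) := by
    nlinarith [mul_nonneg (by linarith : (0 : ℝ) ≤ 2 ^ (2 * b) - 1) hb0]
  have h6 := le_of_mul_le_mul_right h5 (by positivity)
  exact_mod_cast h6

/-- The first `m` primes above `R` that do not divide `n`. -/
def selectedSet (R m n : ℕ) : Finset ℕ := {c ∈ range (4 * R + 1) | Selected R m n c}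

theorem mem_selectedSet {R m n c : ℕ} (hR : 1 ≤ R) (h : c ∈ selectedSet R m n) :
    R < c ∧ c ≤ 4 * R ∧ c.Prime ∧ ¬ c ∣ n := by
  obtain ⟨h1, ⟨h2, h3⟩, -⟩ := mem_filter.1 h
  obtain ⟨h4, h5⟩ := (usable_iff (by omega)).1 h3
  exact ⟨h2, by simpa [Nat.lt_succ_iff] using h1, h4, h5⟩

/-- At most `2 ^ b` primes divide `n ≤ 2 ^ 2 ^ b`, and the interval contains at least `2 ^ (2 b) ≥ m
+ 2 ^ b` primes. -/
theorem card_selectedSet {b m n : ℕ} (hn0 : n ≠ 0) (hn : n ≤ 2 ^ 2 ^ b)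
    (hb : 2 ^ (2 * b) * (20 * b + 20) ≤ 2 ^ (4 * b)) (hm : m + 2 ^ b ≤ 2 ^ (2 * b)) :
    #(selectedSet (rangeLen b) m n) = m := by
  set R := rangeLen b with hR
  have hR1 : 1 ≤ R := by rw [hR, rangeLen_eq]; exact Nat.one_le_two_pow
  have h1 := le_card_primes_rangeLen b hb
  rw [← hR] at h1
  have h2 : #{p ∈ Ioc R (4 * R) | p.Prime ∧ p ∣ n} ≤ 2 ^ b := by
    have := mul_card_le_of_prime_dvd (P := {p ∈ Ioc R (4 * R) | p.Prime ∧ p ∣ n}) (r := 1)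
      (fun p hp => ⟨(mem_filter.1 hp).2.1, (mem_filter.1 hp).2.1.two_le⟩) hn0
      (fun p hp => (mem_filter.1 hp).2.2) hn
    omega
  have h3 : #{p ∈ Ioc R (4 * R) | p.Prime} ≤ #{p ∈ Ioc R (4 * R) | p.Prime ∧ p ∣ n} +
      ∑ i ∈ range (4 * R + 1), if R < i ∧ Usable n i then 1 else 0 := by
    rw [← card_filter]
    refine (card_le_card fun p hp => ?_).trans (card_union_le _ _)
    simp only [mem_filter, mem_union, mem_Ioc, mem_range] at hp ⊢
    rw [usable_iff (by omega)]
    by_cases hd : p ∣ n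
    · exact Or.inl ⟨hp.1, hp.2, hd⟩
    · exact Or.inr ⟨by omega, by omega, hp.2, hd⟩
  have h4 := card_filter_first (fun c => R < c ∧ Usable n c) m (4 * R + 1)
  rw [selectedSet]
  refine h4.trans (min_eq_left ?_)
  omega

/-- Exactly one `j < c` makes `1 + n j` divisible by `c`, namely `-1 / n mod c`. The quotient, the
only nonzero term of `modInv`, then inverts `c` modulo `n`. -/
theorem mul_modInv {n c : ℕ} (hc : c.Prime) (hcn : ¬ c ∣ n) :
    (c : ZMod n) * (modInv n c : ZMod n) = 1 := by
  have : Fact c.Prime := ⟨hc⟩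
  have hn0 : (n : ZMod c) ≠ 0 := by rwa [Ne, ZMod.natCast_eq_zero_iff]
  have hiff : ∀ j < c, (1 + n * j) % c = 0 ↔ j = (-(n : ZMod c)⁻¹).val := fun j hj => by
    rw [← Nat.dvd_iff_mod_eq_zero, ← ZMod.natCast_eq_zero_iff]
    push_cast
    constructor
    · intro h
      have : (j : ZMod c) = -(n : ZMod c)⁻¹ := by
        field_simp
        linear_combination h
      rw [← this, ZMod.val_cast_of_lt hj]
    · rintro h
      have : (j : ZMod c) = -(n : ZMod c)⁻¹ := by rw [h, ZMod.natCast_zmod_val]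
      rw [this]
      field_simp
      ring
  have hlt := ZMod.val_lt (-(n : ZMod c)⁻¹)
  set j₀ := (-(n : ZMod c)⁻¹).val with hj₀
  have h1 : modInv n c = (1 + n * j₀) / c := by
    rw [modInv, sum_eq_single_of_mem j₀ (mem_range.2 hlt), if_pos ((hiff j₀ hlt).2 rfl)]
    intro j hj hne
    rw [if_neg fun h => hne ((hiff j (mem_range.1 hj)).1 h)]
  have h2 : c * modInv n c = 1 + n * j₀ := by
    rw [h1]
    exact Nat.mul_div_cancel' (Nat.dvd_of_mod_eq_zero ((hiff j₀ hlt).2 rfl))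
  have h3 := congrArg (Nat.cast : ℕ → ZMod n) h2
  push_cast at h3
  simpa using h3

/-- For most of the selected primes `p` the residue of `k / p` modulo `n` is not close to `0`. -/
theorem card_bad_le {b m n D k : ℕ} (hb1 : 1 ≤ b) (hn : 2 ≤ n) (hnb : n ≤ 2 ^ 2 ^ b)
    (hD : 4 * D + 1 ≤ 2 ^ 2 ^ b) (hk0 : 0 < k) (hkn : k < n) :
    #{p ∈ selectedSet (rangeLen b) m n |
      rangeLen b * ((k * modInv n p : ℕ) : ZMod n).valMinAbs.natAbs < D * n} ≤
        (8 * D + 1) * (2 ^ b / b) := by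
  have : NeZero n := ⟨by omega⟩
  have hR1 : 1 ≤ rangeLen b := by rw [rangeLen_eq]; exact Nat.one_le_two_pow
  set bad := {p ∈ selectedSet (rangeLen b) m n |
      rangeLen b * ((k * modInv n p : ℕ) : ZMod n).valMinAbs.natAbs < D * n} with hbad
  -- Every bad prime divides one of these factors, and none of them vanishes because `0 < k < n`.
  let F : ℕ := ∏ a ∈ Icc (-(4 * D : ℤ)) (4 * D), ((k : ℤ) + n * a).natAbs
  have hF0 : F ≠ 0 := by
    refine prod_ne_zero_iff.2 fun a _ h => ?_
    rw [Int.natAbs_eq_zero] at h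
    have hk : (k : ℤ) = n * (-a) := by linarith
    have h1 : (0 : ℤ) < n * (-a) := by rw [← hk]; exact_mod_cast hk0
    have h2 : (n : ℤ) * (-a) < n * 1 := by rw [← hk, mul_one]; exact_mod_cast hkn
    have h3 : 0 < -a := pos_of_mul_pos_right h1 (by positivity)
    have h4 : -a < 1 := lt_of_mul_lt_mul_left h2 (by positivity)
    omega
  have hFle : F ≤ 2 ^ (2 ^ (b + 1) * (8 * D + 1)) := by
    rw [pow_mul]
    have hcard : #(Icc (-(4 * D : ℤ)) (4 * D)) = 8 * D + 1 := by
      rw [Int.card_Icc]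
      omega
    rw [← hcard, ← prod_const]
    refine prod_le_prod' fun a ha => ?_
    rw [mem_Icc] at ha
    calc ((k : ℤ) + n * a).natAbs ≤ k + n * a.natAbs := by
          refine (Int.natAbs_add_le _ _).trans ?_
          rw [Int.natAbs_mul, Int.natAbs_natCast, Int.natAbs_natCast]
      _ ≤ n + n * (4 * D) := by
          gcongr
          omega
      _ = n * (4 * D + 1) := by ring
      _ ≤ 2 ^ 2 ^ b * 2 ^ 2 ^ b := Nat.mul_le_mul hnb hD
      _ = 2 ^ 2 ^ (b + 1) := by rw [← pow_add, ← two_mul, ← pow_succ']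
  have hdvd : ∀ p ∈ bad, p ∣ F := fun p hp => by
    obtain ⟨hsel, hlt⟩ := mem_filter.1 hp
    obtain ⟨hRp, hp4, hpp, hpn⟩ := mem_selectedSet hR1 hsel
    set y := ((k * modInv n p : ℕ) : ZMod n).valMinAbs with hy
    have hcong : ((p * y - k : ℤ) : ZMod n) = 0 := by
      push_cast
      rw [hy, ZMod.coe_valMinAbs]
      push_cast
      linear_combination (k : ZMod n) * mul_modInv hpp hpn
    obtain ⟨a, ha⟩ := (ZMod.intCast_zmod_eq_zero_iff_dvd _ n).1 hcong
    -- Badness and `p ≤ 4 R` give `|p y| < 4 D n`, which together with `0 < k < n` confines `a` to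
    -- `[-4 D, 4 D]`.
    have hka : (k : ℤ) + n * a = p * y := by linarith
    have hpy : p * y.natAbs < 4 * D * n := by
      calc p * y.natAbs ≤ 4 * rangeLen b * y.natAbs := Nat.mul_le_mul_right _ hp4
        _ = 4 * (rangeLen b * y.natAbs) := by ring
        _ < 4 * (D * n) := by omega
        _ = _ := by ring
    have hpy' : |(p : ℤ) * y| < 4 * D * n := by
      rw [abs_mul, Nat.abs_cast, Int.abs_eq_natAbs]
      exact_mod_cast hpy
    rw [← hka, abs_lt] at hpy'
    have hn' : (0 : ℤ) < n := by exact_mod_cast (by omega : 0 < n)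
    have hkn' : (k : ℤ) < n := by exact_mod_cast hkn
    have ha1 : a < 4 * D := by
      refine lt_of_mul_lt_mul_left (a := (n : ℤ)) ?_ hn'.le
      linarith [hpy'.2, (Int.natCast_nonneg k)]
    have ha2 : -(4 * D : ℤ) - 1 < a := by
      refine lt_of_mul_lt_mul_left (a := (n : ℤ)) ?_ hn'.le
      linarith [hpy'.1]
    refine dvd_trans ?_ (dvd_prod_of_mem _ (mem_Icc.2 ⟨by omega, ha1.le⟩))
    rw [hka, Int.natAbs_mul, Int.natAbs_natCast]
    exact dvd_mul_right _ _
  have h := mul_card_le_of_prime_dvd (P := bad) (r := 4 * b) (fun p hp => by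
    obtain ⟨hRp, -, hpp, -⟩ := mem_selectedSet hR1 (mem_filter.1 hp).1
    rw [rangeLen_eq] at hRp
    exact ⟨hpp, hRp.le⟩) hF0 hdvd hFle
  have h1 : 1 ≤ 2 ^ b / b := (Nat.one_le_div_iff hb1).2 Nat.lt_two_pow_self.le
  have h2 : 2 ^ b < b * (2 ^ b / b + 1) := Nat.lt_mul_div_succ _ hb1
  set z := 2 ^ b / b
  -- Rounding `2 ^ b / b` down loses at most a factor `2`, since the quotient is at least `1`.
  have h3 : 2 ^ b ≤ 2 * (b * z) := by nlinarith
  have h4 : 4 * b * #bad ≤ 4 * b * ((8 * D + 1) * z) := by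
    calc 4 * b * #bad ≤ 2 ^ (b + 1) * (8 * D + 1) := h
      _ = 2 * 2 ^ b * (8 * D + 1) := by ring
      _ ≤ 2 * (2 * (b * z)) * (8 * D + 1) := by gcongr
      _ = _ := by ring
  exact Nat.le_of_mul_le_mul_left h4 (by omega)

end CirculantExpander

/-! ## The connection set -/

namespace CirculantExpander

section ExpanderList

variable {R m S n : ℕ}

theorem sum_map_flatMap_range {E : Type*} [AddCommMonoid E] (g : ℕ → E) (F : ℕ → List ℕ) (k : ℕ) :
    (((List.range k).flatMap F).map g).sum = ∑ i ∈ range k, ((F i).map g).sum := by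
  induction k with
  | zero => simp
  | succ k ih => simp [List.range_succ, sum_range_succ, ih]

theorem sum_map_expanderList {E : Type*} [AddCommMonoid E] (g : ℕ → E) :
    ((expanderList R m S n).map g).sum = ∑ p ∈ selectedSet R m n, ∑ v ∈ bitSet R S,
      (g (v * modInv n p % n) + g (n - v * modInv n p % n)) := by
  rw [expanderList, sum_map_flatMap_range, selectedSet, sum_filter]
  refine sum_congr rfl fun p _ => ?_
  split_ifs with hp
  · rw [sum_map_flatMap_range, bitSet, sum_filter]
    refine sum_congr rfl fun v _ => ?_
    split_ifs with hv <;> simp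
  · simp

theorem length_expanderList :
    (expanderList R m S n).length = 2 * #(selectedSet R m n) * #(bitSet R S) := by
  have h := sum_map_expanderList (R := R) (m := m) (S := S) (n := n) (fun _ => 1)
  simp only [List.map_const', List.sum_replicate, sum_const, smul_eq_mul, mul_one] at h
  rw [h]
  ring

theorem mem_expanderList {a : ℕ} : a ∈ expanderList R m S n ↔ ∃ p ∈ selectedSet R m n,
    ∃ v ∈ bitSet R S, a = v * modInv n p % n ∨ a = n - v * modInv n p % n := by
  simp only [expanderList, selectedSet, bitSet, List.mem_flatMap, List.mem_range, mem_filter,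
    mem_range]
  constructor
  · rintro ⟨p, hp, ha⟩
    split_ifs at ha with hs
    · simp only [List.mem_flatMap, List.mem_range] at ha
      obtain ⟨v, hv, ha⟩ := ha
      split_ifs at ha with hb
      · exact ⟨p, ⟨hp, hs⟩, v, ⟨hv, hb⟩, by simpa using ha⟩
      · simp at ha
    · simp at ha
  · rintro ⟨p, ⟨hp, hs⟩, v, ⟨hv, hb⟩, ha⟩
    refine ⟨p, hp, ?_⟩
    rw [if_pos hs, List.mem_flatMap]
    exact ⟨v, List.mem_range.2 hv, by rw [if_pos hb]; simpa using ha⟩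

/-- Clear denominators: `v / p ≡ ± v' / p'` becomes `v p' ≡ ± v' p`. Both products are below `4 R ^
2`, so the bound on `n` turns the congruence into an equality of integers, or rules it out for the
minus sign. As `p` is a prime larger than `v`, it must equal `p'`. -/
theorem natCast_ne_neg_and_eq (hR : 1 ≤ R) (hn : 8 * (R * R) < n)
    {p p' v v' : ℕ} (hp : p ∈ selectedSet R m n)
    (hp' : p' ∈ selectedSet R m n) (hv0 : 0 < v) (hvR : v < R) (hvR' : v' < R) :
    ((v * modInv n p : ℕ) : ZMod n) ≠ -((v' * modInv n p' : ℕ) : ZMod n) ∧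
      (((v * modInv n p : ℕ) : ZMod n) = ((v' * modInv n p' : ℕ) : ZMod n) → p = p' ∧ v = v') := by
  obtain ⟨hRp, hp4, hpp, hpn⟩ := mem_selectedSet hR hp
  obtain ⟨hRp', hp4', hpp', hpn'⟩ := mem_selectedSet hR hp'
  have e := mul_modInv hpp hpn
  have e' := mul_modInv hpp' hpn'
  have b1 : v * p' < 4 * (R * R) := by nlinarith
  have b2 : v' * p < 4 * (R * R) := by nlinarith
  have b3 : 0 < v * p' := Nat.mul_pos hv0 hpp'.pos
  push_cast
  constructor
  · intro h
    have h1 : ((v * p' + v' * p : ℕ) : ZMod n) = 0 := by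
      push_cast
      linear_combination (p : ZMod n) * p' * h - (v : ZMod n) * p' * e - (v' : ZMod n) * p * e'
    rw [ZMod.natCast_eq_zero_iff] at h1
    have := Nat.le_of_dvd (by omega) h1
    omega
  · intro h
    have h1 : ((v * p' : ℕ) : ZMod n) = ((v' * p : ℕ) : ZMod n) := by
      push_cast
      linear_combination (p : ZMod n) * p' * h - (v : ZMod n) * p' * e + (v' : ZMod n) * p * e'
    rw [ZMod.natCast_eq_natCast_iff'] at h1
    rw [Nat.mod_eq_of_lt (by omega), Nat.mod_eq_of_lt (by omega)] at h1
    have hpp2 : p = p' := by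
      by_contra hne
      have hd : p ∣ v * p' := h1 ▸ dvd_mul_left p v'
      rcases hpp.dvd_mul.1 hd with h2 | h2
      · have := Nat.le_of_dvd hv0 h2
        omega
      · exact hne ((Nat.prime_dvd_prime_iff_eq hpp hpp').1 h2)
    subst hpp2
    exact ⟨rfl, Nat.eq_of_mul_eq_mul_right hpp.pos h1⟩

theorem mod_pos (hR : 1 ≤ R) (hn : 8 * (R * R) < n) {p v : ℕ}
    (hp : p ∈ selectedSet R m n) (hv0 : 0 < v) (hvR : v < R) :
    0 < v * modInv n p % n := by
  obtain ⟨hRp, hp4, hpp, hpn⟩ := mem_selectedSet hR hp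
  refine Nat.pos_of_ne_zero fun h => ?_
  have h1 : ((v * modInv n p : ℕ) : ZMod n) = 0 := by
    rw [ZMod.natCast_eq_zero_iff]
    exact Nat.dvd_of_mod_eq_zero h
  have h2 : (v : ZMod n) = 0 := by
    push_cast at h1
    linear_combination (p : ZMod n) * h1 - (v : ZMod n) * mul_modInv hpp hpn
  rw [ZMod.natCast_eq_zero_iff] at h2
  have := Nat.le_of_dvd hv0 h2
  nlinarith

theorem natCast_of_pair (hn : 0 < n) {x a : ℕ} (ha : a = x % n ∨ a = n - x % n) :
    (a : ZMod n) = (x : ZMod n) ∨ (a : ZMod n) = -(x : ZMod n) := by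
  have : x % n ≤ n := (Nat.mod_lt _ hn).le
  rcases ha with rfl | rfl
  · left; simp
  · right
    rw [Nat.cast_sub this]
    simp

theorem eq_of_common (hR : 1 ≤ R) (hn : 8 * (R * R) < n) {p p' v v' a : ℕ}
    (hp : p ∈ selectedSet R m n)
    (hp' : p' ∈ selectedSet R m n) (hv0 : 0 < v) (hvR : v < R) (hvR' : v' < R)
    (h : a = v * modInv n p % n ∨ a = n - v * modInv n p % n)
    (h' : a = v' * modInv n p' % n ∨ a = n - v' * modInv n p' % n) : p = p' ∧ v = v' := by
  obtain ⟨k1, k2⟩ := natCast_ne_neg_and_eq hR hn hp hp' hv0 hvR hvR'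
  rcases natCast_of_pair (by omega : 0 < n) h with e | e <;> rcases natCast_of_pair (by omega : 0 < n) h' with e' | e'
  · exact k2 (e.symm.trans e')
  · exact absurd (e.symm.trans e') k1
  · exact absurd (by rw [← e', e, neg_neg]) k1
  · exact k2 (neg_injective (e.symm.trans e'))

theorem nodup_expanderList (hR : 1 ≤ R) (hn : 8 * (R * R) < n)
    (h0 : 0 ∉ bitSet R S) : (expanderList R m S n).Nodup := by
  have hpos : ∀ v, v < R → bit S v = 1 → 0 < v := fun v hv hb => Nat.pos_of_ne_zero fun h =>
    h0 (h ▸ mem_filter.2 ⟨mem_range.2 hv, hb⟩)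
  have hmem : ∀ p a, a ∈ (if Selected R m n p then (List.range R).flatMap fun v =>
      if bit S v = 1 then [v * modInv n p % n] ++ [n - v * modInv n p % n] else [] else []) →
      Selected R m n p ∧ ∃ v < R, bit S v = 1 ∧
        (a = v * modInv n p % n ∨ a = n - v * modInv n p % n) := fun p a ha => by
    split_ifs at ha with hs
    · simp only [List.mem_flatMap, List.mem_range] at ha
      obtain ⟨v, hv, ha⟩ := ha
      split_ifs at ha with hb
      · exact ⟨hs, v, hv, hb, by simpa using ha⟩
      · simp at ha
    · simp at ha
  refine List.nodup_flatMap.2 ⟨fun p hp => ?_, List.nodup_range.pairwise_of_forall_ne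
    fun p hp p' hp' hne a ha ha' => hne ?_⟩
  · split_ifs with hs
    · have hps : p ∈ selectedSet R m n := mem_filter.2 ⟨by simpa using hp, hs⟩
      refine List.nodup_flatMap.2 ⟨fun v hv => ?_, List.nodup_range.pairwise_of_forall_ne
        fun v hv v' hv' hne a ha ha' => hne ?_⟩
      · split_ifs with hb
        · rw [List.mem_range] at hv
          have hv0 := hpos v hv hb
          simp only [List.singleton_append, List.nodup_cons, List.mem_singleton, List.not_mem_nil,
            not_false_eq_true, List.nodup_nil, and_self, and_true]
          intro h
          have h1 := natCast_of_pair (by omega : 0 < n) (x := v * modInv n p) (Or.inr h)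
          have h2 := (natCast_ne_neg_and_eq hR hn hps hps hv0 hv hv).1
          have h3 := congrArg (Nat.cast : ℕ → ZMod n) h
          rw [Nat.cast_sub (Nat.mod_lt _ (by omega)).le] at h3
          exact h2 (by simpa using h3)
        · exact List.nodup_nil
      · rw [List.mem_range] at hv hv'
        dsimp only at ha ha'
        split_ifs at ha ha' with hb hb'
        · exact (eq_of_common hR hn hps hps (hpos v hv hb) hv hv' (by simpa using ha)
            (by simpa using ha')).2
        all_goals simp at ha ha'
    · exact List.nodup_nil
  · obtain ⟨hs, v, hv, hb, hva⟩ := hmem p a ha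
    obtain ⟨hs', v', hv', hb', hva'⟩ := hmem p' a ha'
    exact (eq_of_common hR hn (mem_filter.2 ⟨by simpa using hp, hs⟩)
      (mem_filter.2 ⟨by simpa using hp', hs'⟩) (hpos v hv hb) hv hv' hva hva').1

theorem expanderList_symm (hR : 1 ≤ R) (hn : 8 * (R * R) < n)
    (h0 : 0 ∉ bitSet R S) {a : ℕ} (ha : a ∈ expanderList R m S n) :
    0 < a ∧ a < n ∧ n - a ∈ expanderList R m S n := by
  obtain ⟨p, hp, v, hv, h⟩ := mem_expanderList.1 ha
  have hvR : v < R := mem_range.1 (mem_filter.1 hv).1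
  have hv0 : 0 < v := Nat.pos_of_ne_zero fun h => h0 (h ▸ hv)
  have h1 := mod_pos hR hn hp hv0 hvR
  have h2 : v * modInv n p % n < n := Nat.mod_lt _ (by omega)
  refine ⟨by omega, by omega, mem_expanderList.2 ⟨p, hp, v, hv, ?_⟩⟩
  omega

end ExpanderList

/-! ### Graphs from lists of residues. -/

section Graph

open ZMod

theorem exists_graph_of_list {n : ℕ} (hn : 2 ≤ n) {L : List ℕ} (hnd : L.Nodup)
    (hL : ∀ a ∈ L, 0 < a ∧ a < n ∧ n - a ∈ L) {B : ℝ}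
    (hB : ∀ [NeZero n], ∀ k : ZMod n, k ≠ 0 →
      ‖(L.map fun a : ℕ => stdAddChar ((a : ZMod n) * k)).sum‖ ≤ B) :
    ∃ (S : Finset (Fin n)) (G : SimpleGraph (Fin n)) (_ : DecidableRel G.Adj),
      Enumerates L S ∧ G.adjMatrix ℝ = circ S ∧ G.IsRegularOfDegree L.length ∧ lam G ≤ B := by
  obtain ⟨n, rfl⟩ := Nat.exists_eq_add_of_le' hn
  let S : Finset (Fin (n + 2)) := {s | (s : ℕ) ∈ L}
  have hS : ∀ s : Fin (n + 2), s ∈ S ↔ (s : ℕ) ∈ L := fun s => by simp [S]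
  have h0 : (0 : Fin (n + 2)) ∉ S := fun h => by simpa using (hL _ ((hS _).1 h)).1
  have hneg : ∀ s ∈ S, -s ∈ S := fun s hs => by
    obtain ⟨h1, h2, h3⟩ := hL _ ((hS s).1 hs)
    rw [hS, Fin.val_neg', Nat.mod_eq_of_lt (by omega)]
    exact h3
  have hsum : ∀ {E : Type} [AddCommMonoid E] (g : ℕ → E),
      ∑ s ∈ S, g (s : ℕ) = (L.map g).sum := fun g => by
    rw [← List.sum_toFinset g hnd]
    refine sum_bij (fun s _ => (s : ℕ)) (fun s hs => List.mem_toFinset.2 ((hS s).1 hs))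
      (fun s _ s' _ h => Fin.ext h) (fun a ha => ?_) fun _ _ => rfl
    have ha' := List.mem_toFinset.1 ha
    exact ⟨⟨a, (hL a ha').2.1⟩, (hS _).2 ha', rfl⟩
  have hcard : #S = L.length := by
    rw [card_eq_sum_ones, hsum fun _ => 1]
    simp
  refine ⟨S, cayleyGraph S h0 hneg, inferInstance, ⟨hnd, fun a => ⟨fun ha => ?_, ?_⟩⟩,
    adjMatrix_cayleyGraph, hcard ▸ isRegularOfDegree_cayleyGraph, ?_⟩
  · exact ⟨⟨a, (hL a ha).2.1⟩, (hS _).2 ha, rfl⟩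
  · rintro ⟨s, hs, rfl⟩
    exact (hS s).1 hs
  · refine lam_le S _ adjMatrix_cayleyGraph fun k hk => ?_
    rw [hsum fun a : ℕ => stdAddChar ((a : ZMod (n + 2)) * k)]
    exact hB k hk

/-- The sum of the values of a character at `± x k`, where `x k ≡ y`. -/
theorem stdAddChar_add_stdAddChar {n : ℕ} [NeZero n] (x v : ℕ) (k : ZMod n) :
    (stdAddChar (((v * x % n : ℕ) : ZMod n) * k) : ℂ) +
      stdAddChar (((n - v * x % n : ℕ) : ZMod n) * k) =
    ((2 * Real.cos (2 * Real.pi *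
      (((k.val * x : ℕ) : ZMod n).valMinAbs.natAbs / n : ℝ) * v) : ℝ) : ℂ) := by
  have hn : (n : ℂ) ≠ 0 := Nat.cast_ne_zero.2 (NeZero.ne n)
  set y := ((k.val * x : ℕ) : ZMod n).valMinAbs with hy
  have hy' : (y : ZMod n) = k * x := by
    rw [hy, ZMod.coe_valMinAbs]
    push_cast
    rw [ZMod.natCast_zmod_val]
  have h1 : ((v * x % n : ℕ) : ZMod n) * k = ((y * v : ℤ) : ZMod n) := by
    push_cast
    rw [hy', ZMod.natCast_mod]
    push_cast
    ring
  have h2 : ((n - v * x % n : ℕ) : ZMod n) * k = ((-(y * v) : ℤ) : ZMod n) := by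
    rw [Nat.cast_sub (Nat.mod_lt _ (NeZero.pos n)).le, ZMod.natCast_self, zero_sub, neg_mul, h1]
    push_cast
    ring
  -- The cosine is even, so only `|y| / n ∈ [0, 1 / 2]` matters, which is the range where the sample
  -- is controlled.
  have h3 : Real.cos (2 * Real.pi * ((y.natAbs : ℝ) / n) * v) =
      Real.cos (2 * Real.pi * ((y : ℝ) / n) * v) := by
    rw [Nat.cast_natAbs]
    rcases abs_choice y with h | h <;> rw [h]
    rw [← Real.cos_neg]
    congr 1
    push_cast
    ring
  rw [h1, h2, stdAddChar_coe, stdAddChar_coe, h3]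
  push_cast
  rw [Complex.two_cos]
  congr 2 <;> ring

end Graph

end CirculantExpander

/-! ## The main theorem -/

namespace CirculantExpander

open ZMod

/-- Good primes contribute at most `33 t / D` each; the bad ones, at most `m / D` in number,
contribute the trivial bound `t`. With the factor `2` from the pairs `±`, this is `34 / D` times the
degree `2 m t`. -/
theorem exists_graph_expanderList {D t m b n : ℕ} (hD : 2 ≤ D) (hb1 : 1 ≤ b) (hn : 2 ≤ n)
    (hnb : n ≤ 2 ^ 2 ^ b) (h4D : 4 * D + 1 ≤ 2 ^ 2 ^ b)
    (hprimes : 2 ^ (2 * b) * (20 * b + 20) ≤ 2 ^ (4 * b)) (hm : m + 2 ^ b ≤ 2 ^ (2 * b))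
    (hRn : 8 * (rangeLen b * rangeLen b) < n) (htR : t * (D * D + 1) ≤ rangeLen b)
    (hbad : (8 * D + 1) * (2 ^ b / b) * D ≤ m)
    (ht : D * D * Real.log ((D * rangeLen b : ℕ) * (((D * rangeLen b : ℕ) + 1) * 2)) ≤ t) :
    ∃ (S : Finset (Fin n)) (G : SimpleGraph (Fin n)) (_ : DecidableRel G.Adj),
      Enumerates (expanderList (rangeLen b) m (sampleCode D (rangeLen b) (D * rangeLen b) t) n) S ∧
      G.adjMatrix ℝ = circ S ∧ G.IsRegularOfDegree (2 * m * t) ∧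
      lam G ≤ 34 / D * (2 * m * t : ℕ) := by
  have hR1 : 1 ≤ rangeLen b := by rw [rangeLen_eq]; exact Nat.one_le_two_pow
  obtain ⟨hcard, h0, -⟩ := sample_spec (N := D * rangeLen b) (by omega : 0 < D) t htR
  have hsel := card_selectedSet (m := m) (by omega : n ≠ 0) hnb hprimes hm
  have hlen := length_expanderList (R := rangeLen b) (m := m)
    (S := sampleCode D (rangeLen b) (D * rangeLen b) t) (n := n)
  rw [hsel, show #(bitSet _ _) = t from hcard] at hlen
  rw [← hlen]
  refine exists_graph_of_list hn (nodup_expanderList hR1 hRn h0)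
    (fun a ha => expanderList_symm hR1 hRn h0 ha) ?_
  intro _ k hk
  have hk0 : 0 < k.val := Nat.pos_of_ne_zero fun h => hk ((ZMod.val_eq_zero k).1 h)
  have hbadcard := card_bad_le (m := m) hb1 hn hnb h4D hk0 (ZMod.val_lt k)
  rw [sum_map_expanderList, hlen]
  simp only [stdAddChar_add_stdAddChar, ← Complex.ofReal_sum, Complex.norm_real, ← mul_sum,
    Real.norm_eq_abs, abs_mul, abs_two]
  rw [show bitSet (rangeLen b) (sampleCode D (rangeLen b) (D * rangeLen b) t) =
    sample D (rangeLen b) (D * rangeLen b) t from rfl]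
  set R := rangeLen b with hR
  set A := sample D R (D * R) t with hA
  let y : ℕ → ℕ := fun p => ((k.val * modInv n p : ℕ) : ZMod n).valMinAbs.natAbs
  let f : ℕ → ℝ := fun p => ∑ v ∈ A, Real.cos (2 * Real.pi * (y p / n : ℝ) * v)
  have hD0 : (0 : ℝ) < D := by exact_mod_cast (by omega : 0 < D)
  have hn0 : (0 : ℝ) < n := by exact_mod_cast (by omega : 0 < n)
  have hR0 : (0 : ℝ) < R := by exact_mod_cast hR1
  have hgood : ∀ p, ¬ R * y p < D * n → |f p| ≤ 33 * t / D := fun p hp => by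
    refine abs_sum_cos_sample_le hD htR hR1 ht ?_ ?_
    · rw [div_le_div_iff₀ hR0 hn0]
      have : D * n ≤ y p * R := by rw [mul_comm (y p)]; exact not_lt.1 hp
      exact_mod_cast this
    · rw [div_le_div_iff₀ hn0 two_pos, one_mul]
      have h1 : y p ≤ n / 2 := ZMod.natAbs_valMinAbs_le _
      have h2 : y p * 2 ≤ n := by omega
      exact_mod_cast h2
  have htriv : ∀ p, |f p| ≤ t := fun p => by
    refine (abs_sum_le_sum_abs _ _).trans ?_
    refine (sum_le_card_nsmul _ _ 1 fun v _ => Real.abs_cos_le_one _).trans ?_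
    rw [hA, hcard]
    simp
  have hall : ∀ p, |f p| ≤ 33 * t / D + if R * y p < D * n then (t : ℝ) else 0 := fun p => by
    split_ifs with h
    · exact (htriv p).trans (le_add_of_nonneg_left (by positivity))
    · rw [add_zero]
      exact hgood p h
  have hbad' : (#{p ∈ selectedSet R m n | R * y p < D * n} : ℝ) ≤ m / D := by
    rw [le_div_iff₀ hD0]
    exact_mod_cast (Nat.mul_le_mul_right D hbadcard).trans hbad
  have hmain : |∑ p ∈ selectedSet R m n, f p| ≤ m * (33 * t / D) + m / D * t := by
    refine (abs_sum_le_sum_abs _ _).trans ((sum_le_sum fun p _ => hall p).trans ?_)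
    rw [sum_add_distrib, sum_const, hsel, nsmul_eq_mul, ← sum_filter, sum_const, nsmul_eq_mul]
    gcongr
  calc 2 * |∑ p ∈ selectedSet R m n, f p| ≤ 2 * (m * (33 * t / D) + m / D * t) := by gcongr
    _ = _ := by push_cast; ring

/-- A nontrivial character sums to `0` over the whole group, hence to `-1` over the nonzero
elements. -/
theorem exists_graph_complete {n : ℕ} (hn : 2 ≤ n) :
    ∃ (S : Finset (Fin n)) (G : SimpleGraph (Fin n)) (_ : DecidableRel G.Adj),
      Enumerates ((List.range (n - 1)).flatMap fun i => [i + 1]) S ∧ G.adjMatrix ℝ = circ S ∧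
      G.IsRegularOfDegree (n - 1) ∧ lam G ≤ 1 := by
  have hlen : ((List.range (n - 1)).map (· + 1)).length = n - 1 := by simp
  rw [← List.map_eq_flatMap]
  have h := exists_graph_of_list hn (L := (List.range (n - 1)).map (· + 1)) (B := 1)
    (List.nodup_range.map (add_left_injective 1)) (fun a ha => ?_) ?_
  · rwa [hlen] at h
  · simp only [List.mem_map, List.mem_range] at ha ⊢
    obtain ⟨i, hi, rfl⟩ := ha
    exact ⟨by omega, by omega, n - (i + 1) - 1, by omega, by omega⟩
  · intro _ k hk
    have h1 : ∑ x : ZMod n, (stdAddChar (x * k) : ℂ) = 0 := by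
      rw [AddChar.sum_mulShift k (isPrimitive_stdAddChar n), if_neg hk]
      simp
    have h2 : ∑ x : ZMod n, (stdAddChar (x * k) : ℂ) =
        ∑ a ∈ range n, stdAddChar ((a : ZMod n) * k) := by
      refine sum_bij' (fun x _ => x.val) (fun a _ => (a : ZMod n)) (fun x _ => mem_range.2 x.val_lt)
        (fun _ _ => mem_univ _) (fun x _ => ZMod.natCast_zmod_val x)
        (fun a ha => ZMod.val_cast_of_lt (mem_range.1 ha)) fun x _ => by
          rw [ZMod.natCast_zmod_val]
    have h3 : ∀ g : ℕ → ℂ, ∑ a ∈ range n, g a = ∑ i ∈ range (n - 1), g (i + 1) + g 0 := fun g => by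
      rw [← sum_range_succ', Nat.sub_add_cancel (by omega)]
    rw [h2, h3, Nat.cast_zero, zero_mul, AddChar.map_zero_eq_one] at h1
    have h4 : (((List.range (n - 1)).map (· + 1)).map fun a : ℕ =>
        (stdAddChar ((a : ZMod n) * k) : ℂ)).sum =
        ∑ i ∈ range (n - 1), stdAddChar (((i + 1 : ℕ) : ZMod n) * k) := by
      rw [List.map_map]
      rfl
    rw [h4, eq_neg_of_add_eq_zero_left h1]
    simp

/-- The parameters of the construction satisfy all requirements from some level on. -/
theorem exists_level (D τ μ : ℕ) : ∃ b₀, 1 ≤ b₀ ∧ ∀ b, b₀ ≤ b →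
    4 * D + 1 ≤ 2 ^ 2 ^ b ∧ 2 ^ (2 * b) * (20 * b + 20) ≤ 2 ^ (4 * b) ∧
    μ * (2 ^ b / b) + 2 ^ b ≤ 2 ^ (2 * b) ∧ 8 * (rangeLen b * rangeLen b) < 2 ^ 2 ^ (b - 1) ∧
    τ * b * (D * D + 1) ≤ rangeLen b := by
  have hpow : ∀ b c : ℕ, c ≤ b → c ≤ 2 ^ b := fun b c h => h.trans Nat.lt_two_pow_self.le
  have hsq : ∀ b : ℕ, 7 ≤ b → 20 * b + 20 ≤ 2 ^ b * 2 ^ b := fun b hb => by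
    have h1 := hpow b b le_rfl
    have h2 : 2 ^ 7 ≤ 2 ^ b := Nat.pow_le_pow_right two_pos hb
    nlinarith
  have hexp : ∀ b : ℕ, 8 ≤ b → 8 * b + 4 ≤ 2 ^ (b - 1) := fun b hb => by
    induction b, hb using Nat.le_induction with
    | base => norm_num
    | succ b hb ih =>
      rw [show b + 1 - 1 = (b - 1) + 1 by omega, pow_succ]
      omega
  refine ⟨8 + (4 * D + 1) + (μ + 1) + τ * (D * D + 1), by omega, fun b hb => ⟨?_, ?_, ?_, ?_, ?_⟩⟩
  · exact (hpow b _ (by omega)).trans Nat.lt_two_pow_self.le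
  · rw [show 4 * b = 2 * b + (b + b) by ring, pow_add _ (2 * b), pow_add _ b]
    exact Nat.mul_le_mul_left _ (hsq b (by omega))
  · calc μ * (2 ^ b / b) + 2 ^ b ≤ μ * 2 ^ b + 2 ^ b := by
          gcongr
          exact Nat.div_le_self _ _
      _ = (μ + 1) * 2 ^ b := by ring
      _ ≤ 2 ^ b * 2 ^ b := Nat.mul_le_mul_right _ (hpow b _ (by omega))
      _ = 2 ^ (2 * b) := by ring
  · rw [rangeLen_eq, show 8 * (2 ^ (4 * b) * 2 ^ (4 * b)) = 2 ^ (8 * b + 3) by ring]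
    exact Nat.pow_lt_pow_right one_lt_two (by have := hexp b (by omega); omega)
  · have h1 := hpow b b le_rfl
    have h2 := hpow b (τ * (D * D + 1)) (by omega)
    calc τ * b * (D * D + 1) = τ * (D * D + 1) * b := by ring
      _ ≤ 2 ^ b * 2 ^ b := Nat.mul_le_mul h2 h1
      _ ≤ rangeLen b := Nat.le_mul_of_pos_right _ (by positivity)

/-- With `N = D * 2 ^ (4 b)` the number of tests is at most `2 ^ ((2 D + 8) b)`, so `O(b)` elements
suffice for the sample once `D` is fixed. -/
theorem log_card_tests_le {D b : ℕ} (hD : 1 ≤ D) (hb : 1 ≤ b) :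
    D * D * Real.log ((D * rangeLen b : ℕ) * (((D * rangeLen b : ℕ) + 1) * 2)) ≤
      (D * D * (2 * D + 8) * b : ℕ) := by
  have hR1 : 1 ≤ rangeLen b := by rw [rangeLen_eq]; exact Nat.one_le_two_pow
  have h1 : D * rangeLen b * ((D * rangeLen b + 1) * 2) ≤ 2 ^ ((2 * D + 8) * b) := by
    have hN : 1 ≤ D * rangeLen b := Nat.mul_pos hD hR1
    have h2D : 2 * D ≤ 2 ^ D := by
      rcases D with _ | D
      · simp
      · rw [pow_succ, mul_comm]
        exact Nat.mul_le_mul_right 2 (Nat.lt_two_pow_self)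
    calc D * rangeLen b * ((D * rangeLen b + 1) * 2)
        ≤ D * rangeLen b * ((D * rangeLen b + D * rangeLen b) * 2) := by gcongr
      _ = (2 * D) * (2 * D) * (rangeLen b * rangeLen b) := by ring
      _ ≤ 2 ^ D * 2 ^ D * (rangeLen b * rangeLen b) := by gcongr
      _ = 2 ^ (2 * D + 8 * b) := by rw [rangeLen_eq]; ring
      _ ≤ 2 ^ ((2 * D + 8) * b) := Nat.pow_le_pow_right two_pos (by nlinarith)
  have hpos : 0 < D * rangeLen b * ((D * rangeLen b + 1) * 2) := by positivity
  have h2 : Real.log ((D * rangeLen b : ℕ) * (((D * rangeLen b : ℕ) + 1) * 2)) ≤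
      ((2 * D + 8) * b : ℕ) := by
    have h3 : (((D * rangeLen b : ℕ) : ℝ) * ((((D * rangeLen b : ℕ) : ℝ) + 1) * 2)) ≤
        2 ^ ((2 * D + 8) * b) := by exact_mod_cast h1
    refine (Real.log_le_log (by exact_mod_cast hpos) h3).trans ?_
    rw [Real.log_pow]
    exact mul_le_of_le_one_right (Nat.cast_nonneg _) (by linarith [Real.log_two_lt_d9])
  calc _ ≤ (D * D : ℝ) * ((2 * D + 8) * b : ℕ) := by gcongr
    _ = _ := by push_cast; ring

end CirculantExpander

open CirculantExpander in
theorem mainTheorem10 (ε : ℝ) (hε0 : 0 < ε) (hε1 : ε < 1) :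
    ∃ (p : RAM.Prog) (K k : ℕ) (C : ℝ), ∀ n : ℕ, 2 ≤ n →
      ∃ (t : ℕ) (L : List ℕ) (S : Finset (Fin n)) (d : ℕ)
        (G : SimpleGraph (Fin n)) (_ : DecidableRel G.Adj),
        RAM.Outputs p n t L ∧
        (t : ℝ) ≤ K * Real.logb 2 n ^ k ∧
        CirculantExpander.Enumerates L S ∧
        G.adjMatrix ℝ = CirculantExpander.circ S ∧
        G.IsRegularOfDegree d ∧
        1 ≤ d ∧ (d : ℝ) ≤ C * Real.logb 2 n ∧
        CirculantExpander.lam G ≤ max ε (1 / ((n : ℝ) - 1)) * d := by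
  obtain ⟨D, hD⟩ := exists_nat_ge (34 / ε)
  have hD34 : 34 < D := by
    have : (34 : ℝ) < D := lt_of_lt_of_le (by rw [lt_div_iff₀ hε0]; linarith) hD
    exact_mod_cast this
  have hDε : 34 / (D : ℝ) ≤ ε := by
    rw [div_le_iff₀ hε0] at hD
    rw [div_le_iff₀ (by exact_mod_cast (by omega : 0 < D))]
    linarith
  -- `τ b` is the sample size required by `log_card_tests_le`; `μ` is `D` times the constant in
  -- `card_bad_le`, so that bad primes make up at most `1 / D` of those selected.
  let τ := D * D * (2 * D + 8)
  let μ := (8 * D + 1) * D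
  obtain ⟨b₀, hb₀, H⟩ := exists_level D τ μ
  obtain ⟨p, K, k, hp⟩ := RAM.exists_prog_outputList D τ μ b₀
  -- The first constant bounds `n - 1` below the threshold, where `log₂ n ≥ 1`. The second bounds `2
  -- μ τ (2 ^ b / b) b / log₂ n` above it, using `2 ^ b ≤ 2 log₂ n`.
  refine ⟨p, K, k, max (2 ^ 2 ^ b₀ : ℝ) (4 * μ * τ), fun n hn => ?_⟩
  obtain ⟨t, hout, ht⟩ := hp n hn
  have hlog : (Nat.log 2 n : ℝ) ≤ Real.logb 2 n := Real.natLog_le_logb n 2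
  have hlog1 : (1 : ℝ) ≤ Real.logb 2 n :=
    le_trans (by exact_mod_cast Nat.log_pos one_lt_two hn) hlog
  have hn2 : (2 : ℝ) ≤ n := by exact_mod_cast hn
  set b := level n with hb
  rcases lt_or_ge b b₀ with hlt | hge
  · obtain ⟨S, G, inst, hS, hA, hd, hlam⟩ := exists_graph_complete hn
    refine ⟨t, _, S, n - 1, G, inst, hout, ht, ?_, hA, hd, by omega, ?_, hlam.trans ?_⟩
    · simpa only [outputList, if_pos hlt, if_neg hlt.not_ge, List.append_nil] using hS
    · have h1 : n - 1 ≤ 2 ^ 2 ^ b₀ := (Nat.sub_le _ _).trans ((lt_two_pow_level n).le.trans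
        (Nat.pow_le_pow_right two_pos (Nat.pow_le_pow_right two_pos hlt.le)))
      have h2 : ((n - 1 : ℕ) : ℝ) ≤ 2 ^ 2 ^ b₀ := by exact_mod_cast h1
      calc ((n - 1 : ℕ) : ℝ) ≤ max (2 ^ 2 ^ b₀ : ℝ) (4 * μ * τ) * 1 := by
            rw [mul_one]; exact h2.trans (le_max_left _ _)
        _ ≤ _ := by gcongr
    · rw [Nat.cast_sub (by omega), Nat.cast_one]
      calc (1 : ℝ) = 1 / ((n : ℝ) - 1) * (n - 1) := by field_simp [show (n : ℝ) - 1 ≠ 0 by linarith]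
        _ ≤ _ := mul_le_mul_of_nonneg_right (le_max_right _ _) (by linarith)
  · obtain ⟨h4D, hprimes, hm, hRn, htR⟩ := H b hge
    have hb1 : 1 ≤ b := hb₀.trans hge
    have hle := two_pow_two_pow_le hn (show b - 1 < level n by omega)
    obtain ⟨S, G, inst, hS, hA, hd, hlam⟩ := exists_graph_expanderList (D := D) (t := τ * b)
      (m := μ * (2 ^ b / b)) (b := b) (by omega) hb1 hn (lt_two_pow_level n).le h4D hprimes hm
      (hRn.trans_le hle) htR (le_of_eq (by simp only [μ]; ring)) (log_card_tests_le (by omega) hb1)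
    have h1 : 1 ≤ 2 ^ b / b := (Nat.one_le_div_iff hb1).2 Nat.lt_two_pow_self.le
    refine ⟨t, _, S, _, G, inst, hout, ht, ?_, hA, hd, ?_, ?_, hlam.trans ?_⟩
    · simpa only [outputList, if_neg hge.not_gt, if_pos hge, List.range_zero, List.flatMap_nil,
        List.nil_append] using hS
    · have hτ : 0 < τ := by positivity
      have hμ : 0 < μ := by positivity
      exact Nat.mul_pos (Nat.mul_pos two_pos (Nat.mul_pos hμ h1)) (Nat.mul_pos hτ hb1)
    · have h2 : 2 * (μ * (2 ^ b / b)) * (τ * b) ≤ 4 * μ * τ * Nat.log 2 n := by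
        calc 2 * (μ * (2 ^ b / b)) * (τ * b) = 2 * μ * τ * (2 ^ b / b * b) := by ring
          _ ≤ 2 * μ * τ * (2 * Nat.log 2 n) := by
              exact Nat.mul_le_mul_left _ ((Nat.div_mul_le_self _ _).trans (two_pow_level_le hn))
          _ = _ := by ring
      have h3 : ((2 * (μ * (2 ^ b / b)) * (τ * b) : ℕ) : ℝ) ≤ 4 * μ * τ * Nat.log 2 n := by
        exact_mod_cast h2
      exact h3.trans (mul_le_mul (le_max_right _ _) hlog (Nat.cast_nonneg _) (by positivity))
    · exact mul_le_mul_of_nonneg_right (hDε.trans (le_max_left _ _)) (Nat.cast_nonneg _)
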